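/- Let $X$ be a (Hausdorff) complex manifold of dimension $n$ on which a finite group $G$ acts by holomorphic automorphisms. Let $x\in X$, put $H=\mathrm{Stab}(x)$ and $X_H=\{y\in X:\mathrm{Stab}(y)=H\}$, and let $X_H^i$ be the connected component of $X_H$ that contains $x$; it is a locally closed complex submanifold of $X$. Let $\pi:N=TX|_{X_H^i}/TX_H^i\to X_H^i$ be its holomorphic normal bundle, on which $H$ acts by $h\cdot(y,[v])=(y,[dh_y v])$. Let $W_x$ be a linear slice at $x$: an open $H$-invariant neighbourhood of $x$ with $W_x\cap gW_x=\varnothing$ for all $g\in G\setminus H$, together with a biholomorphism $\varphi$ of $W_x$ onto an open subset of $\mathbb C^n$ that is $H$-equivariant for a linear action $\sigma$ of $H$ on $\mathbb C^n$. Write $\mathbb C^n=(\mathbb C^n)^H\oplus C$ with $C=\ker\big(\sum_{h\in H}\sigma(h)\big)$, the unique $H$-invariant complement, put $W^i_{x,H}=W_x\cap X_H^i$, and assume that $\varphi(W_x)\subseteq\varphi(W^i_{x,H})\times C$, that is, for every $w\in W_x$ there is $y\in W^i_{x,H}$ with $\varphi(w)-\varphi(y)\in C$. (This holds, for example, if $\varphi(W_x)$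 is a box $A\times B\subseteq(\mathbb C^n)^H\times C$ with $A$ connected.) For a complex manifold $M$ and an analytic subset $Z$ with ideal sheaf $\mathcal J$ of holomorphic functions vanishing on $Z$, the formal completion of $M$ along $Z$ is the $\mathbb C$-ringed space $\big(Z,\varprojlim_\nu(\mathcal O_M/\mathcal J^{\nu+1})|_Z\big)$; a holomorphic map $f:M\to M'$ with $f(Z)\subseteq Z'$ induces a morphism of formal completions by pull-back of functions. Then there is an $H$-equivariant holomorphic open embedding $\zeta:W_x\hookrightarrow N|_{W^i_{x,H}}$ (a biholomorphism onto an $H$-invariant open subset $V_\epsilon=\zeta(W_x)$ of $N|_{W^i_{x,H}}$) that maps $W^i_{x,H}$ into the zero section $\Sigma_0$, such that the induced morphism of $\mathbb C$-ringed spaces $\hat\zeta:\widehat W_x\to\widehat V_\epsilon$ is an isomorphism and is $H$-equivariant. Here $\widehat W_x$ is the formal completion of $W_x$ along $W^i_{x,H}$ and $\widehat V_\epsilon$ is the formal completion of $V_\epsilon$ along $\Sigma_0\cap V_\epsilon$, each with the induced action of $H$. -/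

import Mathlib

open CategoryTheory TopologicalSpace Opposite Topology
open scoped Manifold ContDiff

universe u

set_option linter.unusedSectionVars false

noncomputable section

namespace HolTube

section FormalCompletion

variable (E : Type) [NormedAddCommGroup E] [NormedSpace ℂ E]
variable {M : Type u} [TopologicalSpace M] [ChartedSpace E M]

instance germAlgebra (y : M) : Algebra ℂ ((𝓝 y).Germ ℂ) :=
  Algebra.ofModule
    (fun r a b => Quotient.inductionOn₂' a b fun f g =>
      congrArg (Filter.Germ.ofFun (l := 𝓝 y)) (smul_mul_assoc r f g))
    (fun r a b => Quotient.inductionOn₂' a b fun f g =>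
      congrArg (Filter.Germ.ofFun (l := 𝓝 y)) (mul_smul_comm r f g))

/-- The stalk `𝒪_{M,y}`: germs at `y` of holomorphic functions on the complex manifold `M`. -/
def holGerm (y : M) : Subalgebra ℂ ((𝓝 y).Germ ℂ) where
  carrier := {g | ∃ f : M → ℂ, ContMDiffAt 𝓘(ℂ, E) 𝓘(ℂ, ℂ) ω f y ∧ (f : (𝓝 y).Germ ℂ) = g}
  mul_mem' := by
    rintro _ _ ⟨f, hf, rfl⟩ ⟨g, hg, rfl⟩
    exact ⟨f * g, hf.mul hg, rfl⟩
  add_mem' := by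
    rintro _ _ ⟨f, hf, rfl⟩ ⟨g, hg, rfl⟩
    exact ⟨f + g, hf.add hg, rfl⟩
  algebraMap_mem' := fun r =>
    ⟨fun _ => r, contMDiffAt_const, by
      rw [Algebra.algebraMap_eq_smul_one]
      exact congrArg (Filter.Germ.ofFun (l := 𝓝 y)) (funext fun _ => (mul_one r).symm)⟩

/-- The germ at `y` of a function which is holomorphic at `y`. -/
def holGerm.mk {y : M} (f : M → ℂ) (hf : ContMDiffAt 𝓘(ℂ, E) 𝓘(ℂ, ℂ) ω f y) : holGerm E y :=
  ⟨(f : (𝓝 y).Germ ℂ), f, hf, rfl⟩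

/-- The stalk at `y` of the ideal sheaf of `Z`: germs of holomorphic functions vanishing on `Z`. -/
def vanishingIdeal (Z : Set M) (y : M) : Ideal (holGerm E y) where
  carrier := {g | ∃ f : M → ℂ, (f : (𝓝 y).Germ ℂ) = g ∧ ∀ᶠ z in 𝓝 y, z ∈ Z → f z = 0}
  zero_mem' := ⟨0, rfl, by simp⟩
  add_mem' := by
    rintro a b ⟨f, hf, hf'⟩ ⟨g, hg, hg'⟩
    refine ⟨f + g, ?_, ?_⟩
    · rw [Subalgebra.coe_add, ← hf, ← hg]; rfl
    · filter_upwards [hf', hg'] with z h1 h2 hz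
      simp [h1 hz, h2 hz]
  smul_mem' := by
    rintro ⟨_, c, hc, rfl⟩ a ⟨f, hf, hf'⟩
    refine ⟨c * f, ?_, ?_⟩
    · rw [smul_eq_mul, Subalgebra.coe_mul, ← hf]; rfl
    · filter_upwards [hf'] with z h1 hz
      simp [h1 hz]

/-- The stalk `𝒪_{M,y} / 𝓘_{Z,y}^{ν+1}` of the `ν`-th infinitesimal neighbourhood of `Z`. -/
def InfNbhd (Z : Set M) (y : M) (ν : ℕ) : Type u :=
  holGerm E y ⧸ (vanishingIdeal E Z y) ^ (ν + 1)

instance InfNbhd.commRing (Z : Set M) (y : M) (ν : ℕ) : CommRing (InfNbhd E Z y ν) :=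
  inferInstanceAs (CommRing (holGerm E y ⧸ (vanishingIdeal E Z y) ^ (ν + 1)))

instance InfNbhd.algebra (Z : Set M) (y : M) (ν : ℕ) : Algebra ℂ (InfNbhd E Z y ν) :=
  inferInstanceAs (Algebra ℂ (holGerm E y ⧸ (vanishingIdeal E Z y) ^ (ν + 1)))

/-- The quotient map `𝒪_{M,y} → 𝒪_{M,y} / 𝓘_{Z,y}^{ν+1}`. -/
def InfNbhd.mk (Z : Set M) (y : M) (ν : ℕ) : holGerm E y →ₐ[ℂ] InfNbhd E Z y ν :=
  Ideal.Quotient.mkₐ ℂ _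

/-- The projection `𝒪_{M,y} / 𝓘^{ν+2} → 𝒪_{M,y} / 𝓘^{ν+1}`. -/
def InfNbhd.proj (Z : Set M) (y : M) (ν : ℕ) : InfNbhd E Z y (ν + 1) →ₐ[ℂ] InfNbhd E Z y ν :=
  Ideal.Quotient.factorₐ ℂ (Ideal.pow_le_pow_right (Nat.le_succ (ν + 1)))

/-- The sections over the open set `U` of `Z` of `lim_ν (𝒪_M / 𝓘_Z^{ν+1})|_Z`. A section of
`(𝒪_M / 𝓘_Z^{ν+1})|_Z` is a family of elements of the stalks `𝒪_{M,y} / 𝓘_{Z,y}^{ν+1}` which is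
locally the family of classes of a holomorphic function on an open set of `M`; an element of the
limit is a sequence of such sections which is compatible with the projections. -/
def formalSections (Z : Set M) (U : Opens Z) :
    Subalgebra ℂ (∀ (y : U) (ν : ℕ), InfNbhd E Z (y : Z).1 ν) where
  carrier := {s |
    (∀ (y : U) (ν : ℕ), InfNbhd.proj E Z (y : Z).1 ν (s y (ν + 1)) = s y ν) ∧
    ∀ (ν : ℕ) (y : U), ∃ O : Set M, IsOpen O ∧ (y : Z).1 ∈ O ∧ ∃ f : M → ℂ,
      ∃ hf : ∀ z ∈ O, ContMDiffAt 𝓘(ℂ, E) 𝓘(ℂ, ℂ) ω f z,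
        ∀ (z : U) (hz : (z : Z).1 ∈ O),
          s z ν = InfNbhd.mk E Z (z : Z).1 ν (holGerm.mk E f (hf _ hz))}
  mul_mem' := by
    rintro s t ⟨hs, hs'⟩ ⟨ht, ht'⟩
    refine ⟨fun y ν => ?_, fun ν y => ?_⟩
    · simp only [Pi.mul_apply, map_mul, hs, ht]
    · obtain ⟨O, hO, hyO, f, hf, hfs⟩ := hs' ν y
      obtain ⟨O', hO', hyO', g, hg, hgt⟩ := ht' ν y
      refine ⟨O ∩ O', hO.inter hO', ⟨hyO, hyO'⟩, f * g,
        fun z hz => (hf z hz.1).mul (hg z hz.2), fun z hz => ?_⟩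
      simp only [Pi.mul_apply]
      rw [hfs z hz.1, hgt z hz.2, ← map_mul]
      rfl
  add_mem' := by
    rintro s t ⟨hs, hs'⟩ ⟨ht, ht'⟩
    refine ⟨fun y ν => ?_, fun ν y => ?_⟩
    · simp only [Pi.add_apply, map_add, hs, ht]
    · obtain ⟨O, hO, hyO, f, hf, hfs⟩ := hs' ν y
      obtain ⟨O', hO', hyO', g, hg, hgt⟩ := ht' ν y
      refine ⟨O ∩ O', hO.inter hO', ⟨hyO, hyO'⟩, f + g,
        fun z hz => (hf z hz.1).add (hg z hz.2), fun z hz => ?_⟩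
      simp only [Pi.add_apply]
      rw [hfs z hz.1, hgt z hz.2, ← map_add]
      rfl
  algebraMap_mem' := fun r => by
    refine ⟨fun y ν => ?_, fun ν y => ⟨Set.univ, isOpen_univ, trivial, fun _ => r,
      fun _ _ => contMDiffAt_const, fun z _ => ?_⟩⟩
    · simp only [Pi.algebraMap_apply, AlgHom.commutes]
    · have h : holGerm.mk E (fun _ => r) contMDiffAt_const
          = algebraMap ℂ (holGerm E (z : Z).1) r := by
        apply Subtype.ext
        change _ = algebraMap ℂ ((𝓝 (z : Z).1).Germ ℂ) r
        rw [Algebra.algebraMap_eq_smul_one]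
        exact congrArg (Filter.Germ.ofFun (l := 𝓝 (z : Z).1)) (funext fun _ => (mul_one r).symm)
      rw [h, AlgHom.commutes]
      rfl

variable {E} in
/-- Restriction of formal sections to a smaller open set. -/
def formalSections.res {Z : Set M} {U V : Opens Z} (h : V ≤ U) :
    formalSections E Z U →ₐ[ℂ] formalSections E Z V where
  toFun s := ⟨fun y => s.1 ⟨y.1, h y.2⟩, fun y ν => s.2.1 ⟨y.1, h y.2⟩ ν, fun ν y => by
    obtain ⟨O, hO, hyO, f, hf, hfs⟩ := s.2.2 ν ⟨y.1, h y.2⟩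
    exact ⟨O, hO, hyO, f, hf, fun z hz => hfs ⟨z.1, h z.2⟩ hz⟩⟩
  map_one' := rfl
  map_mul' _ _ := rfl
  map_zero' := rfl
  map_add' _ _ := rfl
  commutes' _ := rfl

/-- The presheaf of `ℂ`-algebras `U ↦ formalSections E Z U` on `Z`. -/
def formalPresheaf (Z : Set M) : TopCat.Presheaf (CommAlgCat.{u} ℂ) (TopCat.of Z) where
  obj U := CommAlgCat.of ℂ (formalSections E Z U.unop)
  map i := CommAlgCat.ofHom (formalSections.res (leOfHom i.unop))


variable {E} in
theorem formalSections.existsUnique_glue {Z : Set M} {ι : Type*} (U : ι → Opens Z)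
    (s : ∀ i, formalSections E Z (U i))
    (hs : ∀ (i j : ι) (y : Z) (hi : y ∈ U i) (hj : y ∈ U j),
      (s i).1 ⟨y, hi⟩ = (s j).1 ⟨y, hj⟩) :
    ∃! t : formalSections E Z (iSup U), ∀ i, formalSections.res (le_iSup U i) t = s i := by
  have hU : ∀ y : (iSup U : Opens Z), ∃ i, y.1 ∈ U i := fun y => Opens.mem_iSup.1 y.2
  choose k hk using hU
  refine ⟨⟨fun y => (s (k y)).1 ⟨y.1, hk y⟩, ?_, ?_⟩, ?_, ?_⟩
  · intro y ν
    exact (s (k y)).2.1 ⟨y.1, hk y⟩ ν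
  · intro ν y
    obtain ⟨O, hO, hyO, f, hf, hfs⟩ := (s (k y)).2.2 ν ⟨y.1, hk y⟩
    obtain ⟨O', hO', hO'U⟩ := isOpen_induced_iff.1 (U (k y)).2
    refine ⟨O ∩ O', hO.inter hO', ⟨hyO, ?_⟩, f, fun z hz => hf z hz.1, fun z hz => ?_⟩
    · have : y.1 ∈ (U (k y)).1 := hk y
      rwa [← hO'U] at this
    · have hzU : z.1 ∈ U (k y) := by
        change z.1 ∈ (U (k y)).1
        rw [← hO'U]; exact hz.2
      exact (congrFun (hs (k z) (k y) z.1 (hk z) hzU) ν).trans (hfs ⟨z.1, hzU⟩ hz.1)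
  · intro i
    apply Subtype.ext
    funext y
    exact hs _ _ y.1 _ _
  · intro t ht
    apply Subtype.ext
    funext y
    exact congrFun (congrArg Subtype.val (ht (k y))) ⟨y.1, hk y⟩

theorem formalPresheaf_isSheaf (Z : Set M) : (formalPresheaf E Z).IsSheaf := by
  have : (forget₂ (CommAlgCat.{u} ℂ) (AlgCat.{u} ℂ)).Full :=
    ⟨fun f => ⟨CommAlgCat.ofHom f.hom, rfl⟩⟩
  apply Presheaf.isSheaf_of_isSheaf_comp _ _ (forget₂ (CommAlgCat.{u} ℂ) (AlgCat.{u} ℂ))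
  change TopCat.Presheaf.IsSheaf (formalPresheaf E Z ⋙ forget₂ (CommAlgCat.{u} ℂ) (AlgCat.{u} ℂ))
  rw [TopCat.Presheaf.isSheaf_iff_isSheafUniqueGluing]
  intro ι U sf hsf
  exact formalSections.existsUnique_glue (Z := Z) U sf fun i j y hi hj =>
    congrFun (congrArg (Subtype.val (p := fun t => t ∈ formalSections E Z (U i ⊓ U j))) (hsf i j))
      ⟨y, hi, hj⟩

/-- The formal completion `(Z, lim_ν (𝒪_M / 𝓘_Z^{ν+1})|_Z)` of the complex manifold `M` along `Z`,
as a `ℂ`-ringed space, i.e. a topological space with a sheaf of commutative `ℂ`-algebras. -/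
def formalCompletion (Z : Set M) : AlgebraicGeometry.SheafedSpace (CommAlgCat.{u} ℂ) where
  carrier := TopCat.of Z
  presheaf := formalPresheaf E Z
  IsSheaf := formalPresheaf_isSheaf E Z

variable {M' : Type u} [TopologicalSpace M'] [ChartedSpace E M']

variable {E} in
/-- Pull-back of germs of holomorphic functions along a holomorphic map. -/
def holGerm.comap {f : M → M'} (hf : ContMDiff 𝓘(ℂ, E) 𝓘(ℂ, E) ω f) (y : M) :
    holGerm E (f y) →ₐ[ℂ] holGerm E y where
  toFun g := ⟨g.1.compTendsto f hf.continuous.continuousAt, by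
    obtain ⟨_, g, hg, rfl⟩ := g
    exact ⟨g ∘ f, hg.comp y (hf y), rfl⟩⟩
  map_one' := rfl
  map_mul' := by
    rintro ⟨_, g, hg, rfl⟩ ⟨_, g', hg', rfl⟩
    rfl
  map_zero' := rfl
  map_add' := by
    rintro ⟨_, g, hg, rfl⟩ ⟨_, g', hg', rfl⟩
    rfl
  commutes' r := by
    apply Subtype.ext
    change (algebraMap ℂ ((𝓝 (f y)).Germ ℂ) r).compTendsto f hf.continuous.continuousAt =
      algebraMap ℂ ((𝓝 y).Germ ℂ) r
    rw [Algebra.algebraMap_eq_smul_one, Algebra.algebraMap_eq_smul_one]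
    rfl

variable {E} in
/-- The map `𝒪_{M',f(y)} / 𝓘_{Z'}^{ν+1} → 𝒪_{M,y} / 𝓘_Z^{ν+1}`, `[g] ↦ [g ∘ f]`, induced by a
holomorphic map `f` with `f(Z) ⊆ Z'`. -/
def InfNbhd.comap {f : M → M'} (hf : ContMDiff 𝓘(ℂ, E) 𝓘(ℂ, E) ω f) {Z : Set M} {Z' : Set M'}
    (hZ : Set.MapsTo f Z Z') (y : M) (ν : ℕ) :
    InfNbhd E Z' (f y) ν →ₐ[ℂ] InfNbhd E Z y ν :=
  Ideal.quotientMapₐ _ (holGerm.comap hf y) (by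
    rw [← Ideal.map_le_iff_le_comap, Ideal.map_pow]
    apply Ideal.pow_right_mono
    rw [Ideal.map_le_iff_le_comap]
    rintro ⟨_, g, hg, rfl⟩ ⟨g', hg', hv⟩
    refine ⟨g' ∘ f, ?_, ?_⟩
    · exact congrArg (fun a : (𝓝 (f y)).Germ ℂ =>
        a.compTendsto f hf.continuous.continuousAt) hg'
    · filter_upwards [hf.continuous.continuousAt.eventually hv] with z hz hzZ
      exact hz (hZ hzZ))

variable {E} in
theorem InfNbhd.proj_comap {f : M → M'} (hf : ContMDiff 𝓘(ℂ, E) 𝓘(ℂ, E) ω f) {Z : Set M}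
    {Z' : Set M'} (hZ : Set.MapsTo f Z Z') (y : M) (ν : ℕ) (a : InfNbhd E Z' (f y) (ν + 1)) :
    InfNbhd.proj E Z y ν (InfNbhd.comap hf hZ y (ν + 1) a) =
      InfNbhd.comap hf hZ y ν (InfNbhd.proj E Z' (f y) ν a) := by
  obtain ⟨g, rfl⟩ := Ideal.Quotient.mk_surjective a
  rfl

variable {E} in
/-- The continuous map `Z → Z'` induced by `f`. -/
def formalBase {f : M → M'} (hf : ContMDiff 𝓘(ℂ, E) 𝓘(ℂ, E) ω f) {Z : Set M} {Z' : Set M'}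
    (hZ : Set.MapsTo f Z Z') : TopCat.of Z ⟶ TopCat.of Z' :=
  TopCat.ofHom ⟨hZ.restrict f Z Z', hf.continuous.restrict hZ⟩

variable {E} in
/-- Pull-back of formal sections, `([g_ν])_ν ↦ ([g_ν ∘ f])_ν`. -/
def formalSections.comap {f : M → M'} (hf : ContMDiff 𝓘(ℂ, E) 𝓘(ℂ, E) ω f) {Z : Set M}
    {Z' : Set M'} (hZ : Set.MapsTo f Z Z') (U : Opens Z') :
    formalSections E Z' U →ₐ[ℂ] formalSections E Z ((Opens.map (formalBase hf hZ)).obj U) where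
  toFun s := ⟨fun y ν => InfNbhd.comap hf hZ y.1.1 ν (s.1 ⟨hZ.restrict f Z Z' y.1, y.2⟩ ν), by
    refine ⟨fun y ν => ?_, fun ν y => ?_⟩
    · exact (InfNbhd.proj_comap hf hZ _ _ _).trans
        (congrArg (InfNbhd.comap hf hZ y.1.1 ν) (s.2.1 ⟨hZ.restrict f Z Z' y.1, y.2⟩ ν))
    · obtain ⟨O, hO, hyO, g, hg, hgs⟩ := s.2.2 ν ⟨hZ.restrict f Z Z' y.1, y.2⟩
      exact ⟨f ⁻¹' O, hO.preimage hf.continuous, hyO, g ∘ f,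
        fun z hz => (hg _ hz).comp z (hf z), fun z hz =>
        congrArg (InfNbhd.comap hf hZ z.1.1 ν) (hgs ⟨hZ.restrict f Z Z' z.1, z.2⟩ hz)⟩⟩
  map_one' := Subtype.ext (funext fun _ => funext fun _ => map_one _)
  map_mul' _ _ := Subtype.ext (funext fun _ => funext fun _ => map_mul _ _ _)
  map_zero' := Subtype.ext (funext fun _ => funext fun _ => map_zero _)
  map_add' _ _ := Subtype.ext (funext fun _ => funext fun _ => map_add _ _ _)
  commutes' _ := Subtype.ext (funext fun _ => funext fun _ => AlgHom.commutes _ _)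

variable {E} in
/-- The morphism of `ℂ`-ringed spaces between formal completions induced by a holomorphic map
`f : M → M'` with `f(Z) ⊆ Z'`: on points it is `f|_Z`, on sections it is `[g] ↦ [g ∘ f]`. -/
def formalCompletionMap {f : M → M'} (hf : ContMDiff 𝓘(ℂ, E) 𝓘(ℂ, E) ω f) {Z : Set M}
    {Z' : Set M'} (hZ : Set.MapsTo f Z Z') :
    formalCompletion E Z ⟶ formalCompletion E Z' :=
  InducedCategory.homMk
    { base := formalBase hf hZ
      c := { app U := CommAlgCat.ofHom (formalSections.comap hf hZ U.unop) } }

end FormalCompletion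

section NormalBundle

variable {E : Type} [NormedAddCommGroup E] [NormedSpace ℂ E] [FiniteDimensional ℂ E]
variable {X : Type u} [TopologicalSpace X] [ChartedSpace E X]

variable (E) in
/-- The tangent space `T_y S ⊆ T_y X` of a subset `S` of a complex manifold `X`: the span of the
velocities at `y` of the holomorphic curves in `S` through `y`. -/
def tangentAlong (S : Set X) (y : X) : Submodule ℂ (TangentSpace 𝓘(ℂ, E) y) :=
  Submodule.span ℂ {v | ∃ γ : ℂ → X, ContMDiffAt 𝓘(ℂ, ℂ) 𝓘(ℂ, E) ω γ 0 ∧ γ 0 = y ∧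
    (∀ᶠ t in 𝓝 0, γ t ∈ S) ∧ (mfderiv 𝓘(ℂ, ℂ) 𝓘(ℂ, E) γ 0 (1 : ℂ) : E) = v}

variable (E) in
/-- A holomorphic chart `φ` of `X` in which `S` becomes a linear subspace `L`, together with a
complement `C` of `L`. -/
structure AdaptedChart (S : Set X) where
  φ : OpenPartialHomeomorph X E
  mem_atlas : φ ∈ IsManifold.maximalAtlas 𝓘(ℂ, E) ω X
  L : Submodule ℂ E
  C : Submodule ℂ E
  compl : IsCompl L C
  mem_iff : ∀ z ∈ φ.source, z ∈ S ↔ φ z ∈ L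

variable (E X) in
/-- A (locally closed, complex) submanifold of the complex manifold `X`. -/
structure ComplexSubmanifold where
  carrier : Set X
  exists_chart : ∀ y ∈ carrier, ∃ A : AdaptedChart E carrier, y ∈ A.φ.source

namespace AdaptedChart

variable {S : Set X} (A : AdaptedChart E S)

/-- The projection onto `L` along `C`. -/
def πL : E →L[ℂ] E := LinearMap.toContinuousLinearMap (A.L.projection A.C A.compl)

/-- The projection onto `C` along `L`. -/
def πC : E →L[ℂ] E := LinearMap.toContinuousLinearMap (A.C.projection A.L A.compl.symm)

/-- The differential of the chart at `y`. -/
def d (y : X) : E →L[ℂ] E := mfderiv 𝓘(ℂ, E) 𝓘(ℂ, E) A.φ y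

/-- The differential of the inverse of the chart at `a`. -/
def dinv (a : E) : E →L[ℂ] E := mfderiv 𝓘(ℂ, E) 𝓘(ℂ, E) A.φ.symm a

lemma πL_mem (u : E) : A.πL u ∈ A.L := Submodule.projection_apply_mem _ _
lemma πC_mem (u : E) : A.πC u ∈ A.C := Submodule.projection_apply_mem _ _
lemma πL_of_mem {u : E} (h : u ∈ A.L) : A.πL u = u := Submodule.projection_apply_of_mem_left _ h
lemma πC_of_mem {u : E} (h : u ∈ A.C) : A.πC u = u := Submodule.projection_apply_of_mem_left _ h
lemma πC_eq_zero_iff {u : E} : A.πC u = 0 ↔ u ∈ A.L := Submodule.projection_apply_eq_zero_iff _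
lemma πL_eq_zero_iff {u : E} : A.πL u = 0 ↔ u ∈ A.C := Submodule.projection_apply_eq_zero_iff _
lemma πL_add_πC (u : E) : A.πL u + A.πC u = u :=
  Submodule.projection_add_projection_eq_self A.compl u

variable [IsManifold 𝓘(ℂ, E) ω X]

lemma mdiff : A.φ.MDifferentiable 𝓘(ℂ, E) 𝓘(ℂ, E) :=
  ⟨(contMDiffOn_of_mem_maximalAtlas A.mem_atlas).mdifferentiableOn (by simp),
    (contMDiffOn_symm_of_mem_maximalAtlas A.mem_atlas).mdifferentiableOn (by simp)⟩

lemma dinv_d {y : X} (hy : y ∈ A.φ.source) (v : E) : A.dinv (A.φ y) (A.d y v) = v :=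
  DFunLike.congr_fun (A.mdiff.symm_comp_deriv hy) v

lemma d_dinv {a : E} (ha : a ∈ A.φ.target) (v : E) : A.d (A.φ.symm a) (A.dinv a v) = v :=
  DFunLike.congr_fun (A.mdiff.comp_symm_deriv ha) v

lemma mem_tangentAlong {y : X} (hy : y ∈ A.φ.source) (hyS : y ∈ S) (v : E) :
    v ∈ (tangentAlong E S y : Submodule ℂ E) ↔ A.d y v ∈ A.L := by
  constructor
  · intro hv
    have : (tangentAlong E S y : Submodule ℂ E) ≤ A.L.comap (A.d y).toLinearMap := by
      refine Submodule.span_le.2 ?_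
      rintro w ⟨γ, hγ, rfl, hS, rfl⟩
      have h1 : HasMFDerivAt 𝓘(ℂ, ℂ) 𝓘(ℂ, E) (A.φ ∘ γ) 0
          ((mfderiv 𝓘(ℂ, E) 𝓘(ℂ, E) A.φ (γ 0)).comp (mfderiv 𝓘(ℂ, ℂ) 𝓘(ℂ, E) γ 0)) :=
        (A.mdiff.mdifferentiableAt hy).hasMFDerivAt.comp 0
          (hγ.mdifferentiableAt (by simp)).hasMFDerivAt
      have h2 := h1.hasFDerivAt
      have h3 : ∀ᶠ t in 𝓝 (0 : ℂ), (A.φ ∘ γ) t ∈ A.L := by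
        filter_upwards [hS, hγ.continuousAt.eventually (A.φ.open_source.mem_nhds hy)] with t ht ht'
        exact (A.mem_iff _ ht').1 ht
      have h4 : HasFDerivAt (A.πC ∘ (A.φ ∘ γ)) (A.πC.comp _) (0 : ℂ) :=
        A.πC.hasFDerivAt.comp 0 h2
      have h5 : HasFDerivAt (A.πC ∘ (A.φ ∘ γ)) (0 : ℂ →L[ℂ] E) (0 : ℂ) :=
        (hasFDerivAt_const (0 : E) (0 : ℂ)).congr_of_eventuallyEq (by
          filter_upwards [h3] with t ht
          exact A.πC_eq_zero_iff.2 ht)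
      exact A.πC_eq_zero_iff.1 (DFunLike.congr_fun (h4.unique h5) (1 : ℂ))
    exact this hv
  · intro hv
    refine Submodule.subset_span ⟨fun t => A.φ.symm (A.φ y + t • A.d y v), ?_, ?_, ?_, ?_⟩
    · have : ContMDiffAt 𝓘(ℂ, ℂ) 𝓘(ℂ, E) ω (fun t : ℂ => A.φ y + t • A.d y v) 0 := by
        apply ContDiffAt.contMDiffAt
        fun_prop
      refine ContMDiffAt.comp (0 : ℂ) ?_ this
      apply contMDiffAt_symm_of_mem_maximalAtlas A.mem_atlas
      simpa using A.φ.map_source hy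
    · simpa using A.φ.left_inv hy
    · have hc : ContinuousAt (fun t : ℂ => A.φ y + t • A.d y v) 0 := by fun_prop
      have : ∀ᶠ t in 𝓝 (0 : ℂ), A.φ y + t • A.d y v ∈ A.φ.target :=
        hc.eventually (A.φ.open_target.mem_nhds (by simpa using A.φ.map_source hy))
      filter_upwards [this] with t ht
      rw [A.mem_iff _ (A.φ.map_target ht), A.φ.right_inv ht]
      exact A.L.add_mem ((A.mem_iff _ hy).1 hyS) (A.L.smul_mem _ hv)
    · have h1 : HasFDerivAt (fun t : ℂ => A.φ y + t • A.d y v)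
          ((ContinuousLinearMap.id ℂ ℂ).smulRight (A.d y v)) 0 :=
        ((hasFDerivAt_id (0 : ℂ)).smul_const (A.d y v)).const_add _
      have hy' : A.φ y + (0 : ℂ) • A.d y v ∈ A.φ.target := by simpa using A.φ.map_source hy
      have h2 := (A.mdiff.mdifferentiableAt_symm hy').hasMFDerivAt.comp (0 : ℂ) h1.hasMFDerivAt
      have h3 := h2.mfderiv
      have h4 : (mfderiv 𝓘(ℂ, ℂ) 𝓘(ℂ, E) (A.φ.symm ∘ fun t : ℂ => A.φ y + t • A.d y v) 0
          (1 : ℂ) : E) = A.dinv (A.φ y + (0 : ℂ) • A.d y v) ((1 : ℂ) • A.d y v) := by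
        rw [h3]; rfl
      refine h4.trans ?_
      rw [zero_smul, add_zero, one_smul, A.dinv_d hy]

end AdaptedChart

/-- The total space of the normal bundle `N = TX|_S / TS` of a complex submanifold `S` of `X`. -/
structure NormalBundle (S : ComplexSubmanifold E X) where
  pt : X
  mem : pt ∈ S.carrier
  vec : TangentSpace 𝓘(ℂ, E) pt ⧸ tangentAlong E S.carrier pt


namespace NormalBundle

variable {S : ComplexSubmanifold E X}

/-- The point `(y, [v])` of the normal bundle given by a tangent vector `v ∈ T_y X`, `y ∈ S`. -/
def mk' (y : X) (hy : y ∈ S.carrier) (v : TangentSpace 𝓘(ℂ, E) y) : NormalBundle S :=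
  ⟨y, hy, Submodule.Quotient.mk v⟩

lemma mk'_eq {y y' : X} {hy : y ∈ S.carrier} {hy' : y' ∈ S.carrier} {v v' : E} (h : y = y')
    (hv : v - v' ∈ (tangentAlong E S.carrier y : Submodule ℂ E)) :
    mk' (S := S) y hy v = mk' y' hy' v' := by
  subst h
  exact congrArg (NormalBundle.mk y hy) ((Submodule.Quotient.eq _).2 hv)

lemma exists_mk' (p : NormalBundle S) : ∃ v : E, p = mk' p.pt p.mem v := by
  obtain ⟨y, hy, q⟩ := p
  obtain ⟨v, rfl⟩ := Submodule.Quotient.mk_surjective _ q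
  exact ⟨v, rfl⟩

/-- A tangent vector representing the normal vector `p`. -/
def rep (p : NormalBundle S) : E := p.exists_mk'.choose

lemma mk'_rep (p : NormalBundle S) : mk' p.pt p.mem p.rep = p := p.exists_mk'.choose_spec.symm

lemma rep_mk'_sub {y : X} (hy : y ∈ S.carrier) (v : E) :
    (mk' (S := S) y hy v).rep - v ∈ (tangentAlong E S.carrier y : Submodule ℂ E) := by
  have h := (mk' (S := S) y hy v).mk'_rep
  unfold mk' at h
  rw [NormalBundle.mk.injEq] at h
  exact (Submodule.Quotient.eq _).1 (eq_of_heq h.2)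

variable [IsManifold 𝓘(ℂ, E) ω X]

/-- The coordinate `(y, [v]) ↦ φ(y) + pr_C (dφ_y v)` in `E = L ⊕ C` given by an adapted chart. -/
def coord (A : AdaptedChart E S.carrier) (p : NormalBundle S) : E :=
  A.φ p.pt + A.πC (A.d p.pt p.rep)

lemma coord_mk' (A : AdaptedChart E S.carrier) {y : X} (hy : y ∈ S.carrier)
    (hyA : y ∈ A.φ.source) (v : E) :
    coord A (mk' y hy v) = A.φ y + A.πC (A.d y v) := by
  have h := (A.mem_tangentAlong hyA hy _).1 (rep_mk'_sub hy v)
  rw [map_sub, ← A.πC_eq_zero_iff, map_sub, sub_eq_zero] at h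
  exact congrArg (A.φ y + ·) h

lemma symm_mem (A : AdaptedChart E S.carrier) {u : E} (hu : A.πL u ∈ A.φ.target) :
    A.φ.symm (A.πL u) ∈ S.carrier := by
  rw [A.mem_iff _ (A.φ.map_target hu), A.φ.right_inv hu]
  exact A.πL_mem u

open Classical in
/-- The inverse of `coord`, `a + c ↦ (φ⁻¹(a), [dφ⁻¹_a c])` for `a ∈ L`, `c ∈ C`. -/
def coordInv (A : AdaptedChart E S.carrier) (p₀ : NormalBundle S) (u : E) : NormalBundle S :=
  if h : A.πL u ∈ A.φ.target then
    mk' (A.φ.symm (A.πL u)) (symm_mem A h) (A.dinv (A.πL u) (A.πC u))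
  else p₀

lemma coordInv_of_mem (A : AdaptedChart E S.carrier) (p₀ : NormalBundle S) {u : E}
    (h : A.πL u ∈ A.φ.target) : coordInv A p₀ u =
      mk' (A.φ.symm (A.πL u)) (symm_mem A h) (A.dinv (A.πL u) (A.πC u)) :=
  dif_pos h

lemma πL_coord (A : AdaptedChart E S.carrier) (p : NormalBundle S) (hp : p.pt ∈ A.φ.source) :
    A.πL (coord A p) = A.φ p.pt := by
  rw [coord, map_add, A.πL_of_mem ((A.mem_iff _ hp).1 p.mem), A.πL_eq_zero_iff.2 (A.πC_mem _),
    add_zero]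

lemma πC_coord (A : AdaptedChart E S.carrier) (p : NormalBundle S) (hp : p.pt ∈ A.φ.source) :
    A.πC (coord A p) = A.πC (A.d p.pt p.rep) := by
  rw [coord, map_add, A.πC_eq_zero_iff.2 ((A.mem_iff _ hp).1 p.mem), A.πC_of_mem (A.πC_mem _),
    zero_add]

/-- The chart of the normal bundle over the domain of an adapted chart of `X`. -/
def chart (A : AdaptedChart E S.carrier) (p₀ : NormalBundle S) :
    PartialEquiv (NormalBundle S) E where
  toFun := coord A
  invFun := coordInv A p₀
  source := {p | p.pt ∈ A.φ.source}
  target := {u | A.πL u ∈ A.φ.target}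
  map_source' p hp := by
    change A.πL (coord A p) ∈ A.φ.target
    rw [πL_coord A p hp]
    exact A.φ.map_source hp
  map_target' u hu := by
    rw [coordInv_of_mem A p₀ hu]
    exact A.φ.map_target hu
  left_inv' p hp := by
    have h1 := πL_coord A p hp
    have hp' : A.φ p.pt ∈ A.φ.target := A.φ.map_source hp
    rw [coordInv_of_mem A p₀ (by rw [h1]; exact hp')]
    refine Eq.trans ?_ p.mk'_rep
    refine mk'_eq (by rw [h1, A.φ.left_inv hp]) ?_
    have h2 : A.φ.symm (A.πL (coord A p)) = p.pt := by rw [h1, A.φ.left_inv hp]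
    rw [h2, A.mem_tangentAlong hp p.mem, h1, πC_coord A p hp, map_sub, ← A.πC_eq_zero_iff, map_sub]
    have h3 := A.d_dinv hp' (A.πC (A.d p.pt p.rep))
    rw [A.φ.left_inv hp] at h3
    rw [h3, A.πC_of_mem (A.πC_mem _), sub_self]
  right_inv' u hu := by
    rw [coordInv_of_mem A p₀ hu, coord_mk' A _ (A.φ.map_target hu), A.d_dinv hu,
      A.φ.right_inv hu, A.πC_of_mem (A.πC_mem _), A.πL_add_πC]

lemma tangentAlong_le_comap {f : X → X} (hf : ContMDiff 𝓘(ℂ, E) 𝓘(ℂ, E) ω f) {S : Set X}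
    (hS : Set.MapsTo f S S) (y : X) :
    tangentAlong E S y ≤ (tangentAlong E S (f y)).comap
      (mfderiv 𝓘(ℂ, E) 𝓘(ℂ, E) f y).toLinearMap := by
  refine Submodule.span_le.2 ?_
  rintro w ⟨γ, hγ, rfl, hγS, rfl⟩
  refine Submodule.subset_span ⟨f ∘ γ, (hf _).comp 0 hγ, rfl, ?_, ?_⟩
  · filter_upwards [hγS] with t ht using hS ht
  · rw [mfderiv_comp (0 : ℂ) ((hf _).mdifferentiableAt (by simp))
      (hγ.mdifferentiableAt (by simp))]
    rfl

/-- The map `(y, [v]) ↦ (f(y), [df_y v])` of the normal bundle of `S` induced by a holomorphic map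
`f : X → X` with `f(S) ⊆ S`. -/
def map {f : X → X} (hf : ContMDiff 𝓘(ℂ, E) 𝓘(ℂ, E) ω f)
    (hS : Set.MapsTo f S.carrier S.carrier) (p : NormalBundle S) : NormalBundle S where
  pt := f p.pt
  mem := hS p.mem
  vec := Submodule.mapQ (tangentAlong E S.carrier p.pt) (tangentAlong E S.carrier (f p.pt))
    (mfderiv 𝓘(ℂ, E) 𝓘(ℂ, E) f p.pt).toLinearMap (tangentAlong_le_comap hf hS p.pt) p.vec

lemma map_mk' {f : X → X} (hf : ContMDiff 𝓘(ℂ, E) 𝓘(ℂ, E) ω f)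
    (hS : Set.MapsTo f S.carrier S.carrier) {y : X} (hy : y ∈ S.carrier) (v : E) :
    map hf hS (mk' y hy v) = mk' (f y) (hS hy) (mfderiv 𝓘(ℂ, E) 𝓘(ℂ, E) f y v) := rfl

/-- The local expression of `map f` in the charts of the normal bundle is `u = a + c ↦
τ(a) + pr_{C'} (dτ_a c)`, where `τ = φ' ∘ f ∘ φ⁻¹`. -/
lemma contDiffOn_map {f : X → X} (hf : ContMDiff 𝓘(ℂ, E) 𝓘(ℂ, E) ω f)
    (hS : Set.MapsTo f S.carrier S.carrier) (A B : AdaptedChart E S.carrier)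
    (p₀ : NormalBundle S) :
    ContDiffOn ℂ ω (fun u => coord B (map hf hS (coordInv A p₀ u)))
      {u | A.πL u ∈ A.φ.target ∧ f (A.φ.symm (A.πL u)) ∈ B.φ.source} := by
  set τ : E → E := B.φ ∘ f ∘ A.φ.symm with hτ
  set D : Set E := A.φ.target ∩ A.φ.symm ⁻¹' (f ⁻¹' B.φ.source) with hD
  have hDo : IsOpen D := A.φ.isOpen_inter_preimage_symm (B.φ.open_source.preimage hf.continuous)
  have hτD : ContDiffOn ℂ ω τ D := by
    rw [← contMDiffOn_iff_contDiffOn]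
    refine (contMDiffOn_of_mem_maximalAtlas B.mem_atlas).comp (t := B.φ.source)
      (hf.comp_contMDiffOn ((contMDiffOn_symm_of_mem_maximalAtlas A.mem_atlas).mono
        Set.inter_subset_left)) ?_
    intro a ha
    exact ha.2
  have hdτ : ContDiffOn ℂ ω (fderiv ℂ τ) D := hτD.fderiv_of_isOpen hDo (by simp)
  have hmaps : Set.MapsTo A.πL
      {u | A.πL u ∈ A.φ.target ∧ f (A.φ.symm (A.πL u)) ∈ B.φ.source} D := fun u hu => hu
  have key : ContDiffOn ℂ ω
      (fun u => τ (A.πL u) + B.πC (fderiv ℂ τ (A.πL u) (A.πC u)))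
      {u | A.πL u ∈ A.φ.target ∧ f (A.φ.symm (A.πL u)) ∈ B.φ.source} := by
    refine (hτD.comp A.πL.contDiff.contDiffOn hmaps).add
      (B.πC.contDiff.comp_contDiffOn ?_)
    exact (hdτ.comp A.πL.contDiff.contDiffOn hmaps).clm_apply A.πC.contDiff.contDiffOn
  refine key.congr fun u hu => ?_
  have hu1 : A.πL u ∈ A.φ.target := hu.1
  rw [coordInv_of_mem A p₀ hu1]
  refine (coord_mk' B (hS (symm_mem A hu1)) hu.2 _).trans ?_
  congr 2
  have h0 := (A.mdiff.mdifferentiableAt_symm hu1).hasMFDerivAt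
  have h1 := ((hf (A.φ.symm (A.πL u))).mdifferentiableAt (by simp)).hasMFDerivAt.comp (A.πL u) h0
  have h2 : HasMFDerivAt 𝓘(ℂ, E) 𝓘(ℂ, E) τ (A.πL u) _ :=
    (B.mdiff.mdifferentiableAt hu.2).hasMFDerivAt.comp (A.πL u) h1
  let df : E →L[ℂ] E := mfderiv 𝓘(ℂ, E) 𝓘(ℂ, E) f (A.φ.symm (A.πL u))
  have h3 : HasFDerivAt τ ((B.d (f (A.φ.symm (A.πL u)))).comp (df.comp (A.dinv (A.πL u))))
      (A.πL u) := h2.hasFDerivAt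
  exact (DFunLike.congr_fun h3.fderiv (A.πC u)).symm

lemma map_id (hS : Set.MapsTo id S.carrier S.carrier) (p : NormalBundle S) :
    map (contMDiff_id : ContMDiff 𝓘(ℂ, E) 𝓘(ℂ, E) ω (id : X → X)) hS p = p := by
  obtain ⟨v, hv⟩ := p.exists_mk'
  rw [hv, map_mk']
  refine mk'_eq rfl ?_
  rw [mfderiv_id]
  exact (sub_self v).symm ▸ Submodule.zero_mem _

lemma symm_trans_source (A B : AdaptedChart E S.carrier) (p₀ p₁ : NormalBundle S) :
    ((chart A p₀).symm.trans (chart B p₁)).source =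
      {u | A.πL u ∈ A.φ.target ∧ A.φ.symm (A.πL u) ∈ B.φ.source} := by
  ext u
  rw [PartialEquiv.trans_source]
  refine and_congr_right fun hu => ?_
  change (coordInv A p₀ u).pt ∈ B.φ.source ↔ _
  rw [coordInv_of_mem A p₀ hu]
  rfl

lemma contDiffOn_symm_trans (A B : AdaptedChart E S.carrier) (p₀ p₁ : NormalBundle S) :
    ContDiffOn ℂ ω ((chart A p₀).symm.trans (chart B p₁))
      ((chart A p₀).symm.trans (chart B p₁)).source := by
  rw [symm_trans_source]
  refine (contDiffOn_map contMDiff_id (Set.mapsTo_id _) A B p₀).congr fun u _ => ?_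
  rw [map_id]
  rfl

variable (S) in
/-- The holomorphic atlas of the normal bundle: one chart for each adapted chart of `X`. -/
def core : ChartedSpaceCore E (NormalBundle S) where
  atlas := {e | ∃ A p₀, e = chart A p₀}
  chartAt p := chart (S.exists_chart p.pt p.mem).choose p
  mem_chart_source p := (S.exists_chart p.pt p.mem).choose_spec
  chart_mem_atlas _ := ⟨_, _, rfl⟩
  open_source := by
    rintro _ _ ⟨A, p₀, rfl⟩ ⟨B, p₁, rfl⟩
    rw [symm_trans_source]
    exact (A.φ.isOpen_inter_preimage_symm B.φ.open_source).preimage A.πL.continuous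
  continuousOn_toFun := by
    rintro _ _ ⟨A, p₀, rfl⟩ ⟨B, p₁, rfl⟩
    exact (contDiffOn_symm_trans A B p₀ p₁).continuousOn

instance : TopologicalSpace (NormalBundle S) := (core S).toTopologicalSpace

instance : ChartedSpace E (NormalBundle S) := (core S).toChartedSpace

instance : IsManifold 𝓘(ℂ, E) ω (NormalBundle S) := by
  apply isManifold_of_contDiffOn
  intro e e' he he'
  simp only [atlas, ChartedSpace.atlas, Set.mem_iUnion,
    Set.mem_singleton_iff] at he he'
  obtain ⟨_, ⟨A, p₀, rfl⟩, rfl⟩ := he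
  obtain ⟨_, ⟨B, p₁, rfl⟩, rfl⟩ := he'
  have := contDiffOn_symm_trans A B p₀ p₁
  simp only [modelWithCornersSelf_coe, modelWithCornersSelf_coe_symm, Set.range_id,
    Set.inter_univ, Set.preimage_id, Function.comp_id, Function.id_comp]
  exact this

/-- The induced map of the normal bundle is holomorphic. -/
theorem contMDiff_map {f : X → X} (hf : ContMDiff 𝓘(ℂ, E) 𝓘(ℂ, E) ω f)
    (hS : Set.MapsTo f S.carrier S.carrier) :
    ContMDiff 𝓘(ℂ, E) 𝓘(ℂ, E) ω (map hf hS) := by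
  intro p
  set A := (S.exists_chart p.pt p.mem).choose
  set B := (S.exists_chart (map hf hS p).pt (map hf hS p).mem).choose
  have hpA : p.pt ∈ A.φ.source := (S.exists_chart p.pt p.mem).choose_spec
  have hpB : f p.pt ∈ B.φ.source :=
    (S.exists_chart (map hf hS p).pt (map hf hS p).mem).choose_spec
  set D : Set E := {u | A.πL u ∈ A.φ.target ∧ f (A.φ.symm (A.πL u)) ∈ B.φ.source}
  have hD : IsOpen D := (A.φ.isOpen_inter_preimage_symm
    (B.φ.open_source.preimage hf.continuous)).preimage A.πL.continuous
  have hmem : ∀ q : NormalBundle S, q.pt ∈ A.φ.source → f q.pt ∈ B.φ.source →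
      coord A q ∈ D := fun q h1 h2 => by
    change A.πL (coord A q) ∈ A.φ.target ∧ f (A.φ.symm (A.πL (coord A q))) ∈ B.φ.source
    rw [πL_coord A q h1, A.φ.left_inv h1]
    exact ⟨A.φ.map_source h1, h2⟩
  have hchart : ContMDiffAt 𝓘(ℂ, E) 𝓘(ℂ, E) ω (coord A) p :=
    contMDiffAt_of_mem_maximalAtlas
      (IsManifold.chart_mem_maximalAtlas (I := 𝓘(ℂ, E)) (n := ω) p) (mem_chart_source E p)
  have hnear : ∀ᶠ q in 𝓝 p, q.pt ∈ A.φ.source ∧ coord A q ∈ D :=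
    (show ∀ᶠ q in 𝓝 p, q ∈ (chartAt E p).source from
      (chartAt E p).open_source.mem_nhds (mem_chart_source E p)).and
      (hchart.continuousAt.eventually (hD.mem_nhds (hmem p hpA hpB)))
  have hloc : ContMDiffAt 𝓘(ℂ, E) 𝓘(ℂ, E) ω
      (fun u => coord B (map hf hS (coordInv A p u))) (coord A p) :=
    ((contDiffOn_map hf hS A B p).contDiffAt (hD.mem_nhds (hmem p hpA hpB))).contMDiffAt
  have hinv : (chart A p).symm (coord A p) = p := (chart A p).left_inv hpA
  have hsymm : ContMDiffAt 𝓘(ℂ, E) 𝓘(ℂ, E) ω (coordInv B (map hf hS p))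
      (coord B (map hf hS (coordInv A p (coord A p)))) := by
    have h1 : coordInv A p (coord A p) = p := hinv
    rw [h1]
    exact contMDiffAt_symm_of_mem_maximalAtlas
      (IsManifold.chart_mem_maximalAtlas (I := 𝓘(ℂ, E)) (n := ω) (map hf hS p))
      (mem_chart_target E (map hf hS p))
  refine (hsymm.comp (coord A p) hloc |>.comp p hchart).congr_of_eventuallyEq ?_
  filter_upwards [hnear] with q hq
  have h1 : coordInv A p (coord A q) = q := (chart A p).left_inv hq.1
  have h2 : f q.pt ∈ B.φ.source := by
    have := hq.2.2
    rwa [πL_coord A q hq.1, A.φ.left_inv hq.1] at this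
  change _ = coordInv B (map hf hS p) (coord B (map hf hS (coordInv A p (coord A q))))
  rw [h1]
  exact ((chart B (map hf hS p)).left_inv (x := map hf hS q) h2).symm

end NormalBundle

end NormalBundle

section Action

variable (E : Type) [NormedAddCommGroup E] [NormedSpace ℂ E] [FiniteDimensional ℂ E]
variable (G : Type*) [Group G]
variable {X : Type u} [TopologicalSpace X] [ChartedSpace E X] [MulAction G X]

variable (X) in
/-- The group `G` acts on the complex manifold `X` by holomorphic automorphisms. -/
class HolomorphicAction : Prop where
  contMDiff_smul : ∀ g : G, ContMDiff 𝓘(ℂ, E) 𝓘(ℂ, E) ω (fun y : X => g • y)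

variable {G} in
/-- The isotropy type `X_H = {y | Stab(y) = H}`. -/
def isotropyType (H : Subgroup G) : Set X := {y | MulAction.stabilizer G y = H}

variable [T2Space X] [IsManifold 𝓘(ℂ, E) ω X] [Finite G] [HolomorphicAction E G X]

/-- Near `y` the isotropy type of `y` is a linear subspace in a suitable holomorphic chart
(linearization of the action of the stabilizer by averaging). -/
theorem exists_linearizing_chart (y : X) :
    ∃ φ ∈ IsManifold.maximalAtlas 𝓘(ℂ, E) ω X, ∃ (L : Submodule ℂ E) (r : ℝ), 0 < r ∧
      y ∈ φ.source ∧ φ y = 0 ∧ φ.target = Metric.ball 0 r ∧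
      ∀ z ∈ φ.source, z ∈ isotropyType (MulAction.stabilizer G y) ↔ φ z ∈ L := by
  classical
  have : CompleteSpace E := FiniteDimensional.complete ℂ E
  set H := MulAction.stabilizer G y with hH
  have : Fintype H := Fintype.ofFinite H
  have hsm : ∀ g : G, ContMDiff 𝓘(ℂ, E) 𝓘(ℂ, E) ω (fun y : X => g • y) :=
    HolomorphicAction.contMDiff_smul
  have hfix : ∀ h : H, (h : G) • y = y := fun h => h.2
  set ψ := chartAt E y
  have hψ : ψ ∈ IsManifold.maximalAtlas 𝓘(ℂ, E) ω X := IsManifold.chart_mem_maximalAtlas y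
  have hy : y ∈ ψ.source := mem_chart_source E y
  set a := ψ y
  have ha : a ∈ ψ.target := ψ.map_source hy
  have hay : ψ.symm a = y := ψ.left_inv hy
  let T : H → E → E := fun h u => ψ ((h : G) • ψ.symm u)
  have hTa : ∀ h, T h a = a := fun h => by simp only [T]; rw [hay, hfix]
  have hT : ∀ h, ContDiffAt ℂ ω (T h) a := fun h => by
    rw [← contMDiffAt_iff_contDiffAt]
    have h1 : ContMDiffAt 𝓘(ℂ, E) 𝓘(ℂ, E) ω ψ ((h : G) • ψ.symm a) := by
      rw [hay, hfix]; exact contMDiffAt_of_mem_maximalAtlas hψ hy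
    exact h1.comp a ((hsm h _).comp a (contMDiffAt_symm_of_mem_maximalAtlas hψ ha))
  have hTd : ∀ h, HasFDerivAt (T h) (fderiv ℂ (T h) a) a := fun h =>
    ((hT h).differentiableAt (by simp)).hasFDerivAt
  let σ : H → E →L[ℂ] E := fun h => fderiv ℂ (T h) a
  have hnear : ∀ h : H, ∀ᶠ u in 𝓝 a, (h : G) • ψ.symm u ∈ ψ.source := fun h => by
    have hc : ContinuousAt (fun u => (h : G) • ψ.symm u) a :=
      (hsm h).continuous.continuousAt.comp (ψ.continuousAt_symm ha)
    refine hc.eventually (ψ.open_source.mem_nhds ?_)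
    change (h : G) • ψ.symm a ∈ ψ.source
    rw [hay, hfix]; exact hy
  have hσmul : ∀ h k, σ (h * k) = (σ h).comp (σ k) := fun h k => by
    have h1 : T (h * k) =ᶠ[𝓝 a] T h ∘ T k := by
      filter_upwards [hnear k] with u hu
      simp only [T, Function.comp]
      rw [ψ.left_inv hu, Subgroup.coe_mul, mul_smul]
    have h2 : HasFDerivAt (T h) (σ h) (T k a) := by rw [hTa]; exact hTd h
    exact h1.fderiv_eq.trans (h2.comp a (hTd k)).fderiv
  have hσone : σ 1 = ContinuousLinearMap.id ℂ E := by
    have h1 : T 1 =ᶠ[𝓝 a] id := by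
      filter_upwards [ψ.open_target.mem_nhds ha] with u hu
      simp only [T, OneMemClass.coe_one, one_smul, id]
      exact ψ.right_inv hu
    exact h1.fderiv_eq.trans fderiv_id
  let n : ℂ := (Fintype.card H : ℂ)
  have hn : n ≠ 0 := by simp [n]
  let F : E → E := fun u => n⁻¹ • ∑ h, σ h⁻¹ (T h u - a)
  have hF : ContDiffAt ℂ ω F a := by
    apply contDiffAt_const.smul
    apply ContDiffAt.sum
    intro h _
    exact (σ h⁻¹).contDiff.contDiffAt.comp a ((hT h).sub contDiffAt_const)
  have hFd : HasFDerivAt F ((ContinuousLinearEquiv.refl ℂ E : E ≃L[ℂ] E) : E →L[ℂ] E) a := by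
    have h1 : HasFDerivAt F (n⁻¹ • ∑ h, (σ h⁻¹).comp (σ h)) a := by
      refine HasFDerivAt.const_smul (HasFDerivAt.fun_sum fun h _ => ?_) _
      exact (σ h⁻¹).hasFDerivAt.comp a ((hTd h).sub_const a)
    convert h1 using 1
    have : ∀ h, (σ h⁻¹).comp (σ h) = ContinuousLinearMap.id ℂ E := fun h => by
      rw [← hσmul, inv_mul_cancel, hσone]
    simp only [this, Finset.sum_const, Finset.card_univ]
    rw [← Nat.cast_smul_eq_nsmul ℂ, smul_smul, inv_mul_cancel₀ hn, one_smul]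
    rfl
  have hFa : F a = 0 := by simp [F, hTa]
  -- equivariance of the linearizing map
  have hFeq : ∀ (z : X), z ∈ ψ.source → (∀ h : H, (h : G) • z ∈ ψ.source) → ∀ k : H,
      F (ψ ((k : G) • z)) = σ k (F (ψ z)) := by
    intro z hz hhz k
    simp only [F, T, map_smul, map_sum]
    congr 1
    rw [← Equiv.sum_comp (Equiv.mulRight k⁻¹)]
    refine Finset.sum_congr rfl fun h _ => ?_
    rw [ψ.left_inv hz, ψ.left_inv (hhz k), Equiv.coe_mulRight, ← ContinuousLinearMap.comp_apply,
      ← hσmul, smul_smul]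
    simp
  let e := hF.toOpenPartialHomeomorph F hFd (by simp)
  have he : ∀ u, e u = F u := fun _ => rfl
  have hae : a ∈ e.source := hF.mem_toOpenPartialHomeomorph_source hFd (by simp)
  have he0 : e a = 0 := hFa
  have hei : ContDiffAt ℂ ω e.symm 0 := by
    have := hF.to_localInverse hFd (by simp)
    rw [hFa] at this
    exact this
  let φ₀ := ψ.trans e
  have hyφ : y ∈ φ₀.source := by
    rw [OpenPartialHomeomorph.trans_source]; exact ⟨hy, hae⟩
  have hφy : φ₀ y = 0 := hFa
  have h0t : (0 : E) ∈ φ₀.target := hφy ▸ φ₀.map_source hyφ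
  have h0s : φ₀.symm 0 = y := by rw [← hφy]; exact φ₀.left_inv hyφ
  have hcs : Filter.Tendsto φ₀.symm (𝓝 0) (𝓝 y) := by
    have := φ₀.continuousAt_symm h0t
    rwa [ContinuousAt, h0s] at this
  have hsmc : ∀ g : G, Filter.Tendsto (fun v => g • φ₀.symm v) (𝓝 0) (𝓝 (g • y)) := fun g =>
    ((hsm g).continuous.tendsto y).comp hcs
  have hev : ∀ᶠ v in 𝓝 (0 : E), v ∈ φ₀.target ∧ ContDiffAt ℂ ω e.symm v ∧
      ContDiffAt ℂ ω F (e.symm v) ∧ (∀ h : H, (h : G) • φ₀.symm v ∈ φ₀.source) ∧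
      ∀ g : G, g ∉ H → g • φ₀.symm v ≠ φ₀.symm v := by
    refine (show ∀ᶠ v in 𝓝 (0 : E), v ∈ φ₀.target from φ₀.open_target.mem_nhds h0t).and ((hei.eventually (by simp)).and (Filter.Eventually.and
      ?_ (Filter.Eventually.and ?_ ?_)))
    · have h1 : e.symm 0 = a := by rw [← he0]; exact e.left_inv hae
      have h2 := hei.continuousAt
      rw [ContinuousAt, h1] at h2
      exact h2.eventually (hF.eventually (by simp))
    · rw [Filter.eventually_all]
      intro h
      refine (hsmc h).eventually (φ₀.open_source.mem_nhds ?_)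
      rw [hfix]; exact hyφ
    · rw [Filter.eventually_all]
      intro g
      by_cases hg : g ∈ H
      · exact Filter.Eventually.of_forall fun v hv => absurd hg hv
      · have hne : (g • y, y) ∈ (Set.diagonal X)ᶜ := fun h => hg h
        filter_upwards [((hsmc g).prodMk_nhds hcs).eventually
          (isClosed_diagonal.isOpen_compl.mem_nhds hne)] with v hv _ using hv
  obtain ⟨r, hr, hball⟩ := Metric.eventually_nhds_iff_ball.1 hev
  let φ := (φ₀.symm.restrOpen (Metric.ball 0 r) Metric.isOpen_ball).symm
  have hφt : φ.target = Metric.ball 0 r :=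
    Set.inter_eq_right.2 fun v hv => (hball v hv).1
  have hφs : ∀ z ∈ φ.source, z ∈ φ₀.source ∧ φ₀ z ∈ Metric.ball 0 r := by
    intro z hz
    refine ⟨hz.1, ?_⟩
    have := φ.map_source hz
    rwa [hφt] at this
  have hφb : ∀ z ∈ φ.source, φ z ∈ Metric.ball (0 : E) r := fun z hz => (hφs z hz).2
  have hFφ : ∀ z ∈ φ.source, φ z = F (ψ z) := fun z _ => rfl
  have hzψ : ∀ z ∈ φ.source, z ∈ ψ.source ∧ ψ z ∈ e.source := fun z hz => by
    have := (hφs z hz).1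
    rwa [OpenPartialHomeomorph.trans_source] at this
  have hsy : ∀ z ∈ φ.source, φ₀.symm (φ z) = z := fun z hz => φ₀.left_inv (hφs z hz).1
  have hψz : ∀ z ∈ φ.source, e.symm (φ z) = ψ z := fun z hz => e.left_inv (hzψ z hz).2
  refine ⟨φ, ?_, ⨅ h, LinearMap.ker ((σ h).toLinearMap - LinearMap.id), r, hr, ?_, hφy, hφt, ?_⟩
  · rw [IsManifold.mem_maximalAtlas_iff_contMDiffOn]
    constructor
    · intro z hz
      have h1 : ContDiffAt ℂ ω F (ψ z) := by
        rw [← hψz z hz]; exact (hball _ (hφb z hz)).2.2.1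
      exact (h1.contMDiffAt.comp z
        (contMDiffAt_of_mem_maximalAtlas hψ (hzψ z hz).1)).contMDiffWithinAt
    · intro v hv
      rw [hφt] at hv
      have hb := hball v hv
      have h1 : e.symm v ∈ ψ.target := by
        have := φ₀.map_target hb.1
        have h2 := hb.1
        rw [OpenPartialHomeomorph.trans_target] at h2
        exact h2.2
      exact ((contMDiffAt_symm_of_mem_maximalAtlas hψ h1).comp v
        hb.2.1.contMDiffAt).contMDiffWithinAt
  · refine ⟨hyφ, ?_⟩
    change φ₀ y ∈ Metric.ball 0 r
    rw [hφy]; exact Metric.mem_ball_self hr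
  · intro z hz
    have hb := hball (φ z) (hφb z hz)
    rw [hsy z hz] at hb
    have hmem : ∀ h : H, (h : G) • z ∈ φ₀.source := hb.2.2.2.1
    have hmemψ : ∀ h : H, (h : G) • z ∈ ψ.source := fun h => by
      have := hmem h
      rw [OpenPartialHomeomorph.trans_source] at this
      exact this.1
    have heq := hFeq z (hzψ z hz).1 hmemψ
    simp only [Submodule.mem_iInf, LinearMap.mem_ker, LinearMap.sub_apply, LinearMap.id_apply,
      sub_eq_zero]
    constructor
    · intro hzH h
      have hhz : (h : G) • z = z := by
        have : (h : G) ∈ MulAction.stabilizer G z := by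
          rw [show MulAction.stabilizer G z = H from hzH]; exact h.2
        exact this
      have := heq h
      rw [hhz] at this
      exact this.symm
    · intro hzL
      have hhz : ∀ h : H, (h : G) • z = z := fun h =>
        φ₀.injOn (hmem h) (hφs z hz).1 ((heq h).trans (hzL h))
      change MulAction.stabilizer G z = H
      ext g
      constructor
      · intro hg
        by_contra hgH
        exact hb.2.2.2.2 g hgH hg
      · intro hg
        exact hhz ⟨g, hg⟩

end Action

section Statement

variable (E : Type) [NormedAddCommGroup E] [NormedSpace ℂ E] [FiniteDimensional ℂ E]
variable {G : Type*} [Group G] [Finite G]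
variable {X : Type u} [TopologicalSpace X] [ChartedSpace E X] [T2Space X]
  [IsManifold 𝓘(ℂ, E) ω X] [MulAction G X] [HolomorphicAction E G X]

/-- The stratum through `x`: the connected component `X_H^i` of the isotropy type `X_H`,
`H = Stab(x)`, which contains `x`. -/
def stratum (x : X) : ComplexSubmanifold E X where
  carrier := connectedComponentIn (isotropyType (MulAction.stabilizer G x)) x
  exists_chart := by
    intro y hy
    have hyH : MulAction.stabilizer G y = MulAction.stabilizer G x :=
      connectedComponentIn_subset (isotropyType (MulAction.stabilizer G x)) x hy
    rw [connectedComponentIn_eq hy]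
    obtain ⟨φ, hφ, L, r, hr, hyφ, hφy, hφt, hiff⟩ := exists_linearizing_chart E G y
    rw [hyH] at hiff
    obtain ⟨C, hC⟩ := Submodule.exists_isCompl L
    refine ⟨⟨φ, hφ, L, C, hC, fun z hz => ⟨fun h =>
      (hiff z hz).1 (connectedComponentIn_subset _ _ h), fun h => ?_⟩⟩, hyφ⟩
    have hpre : IsPreconnected (φ.symm '' ((L : Set E) ∩ Metric.ball 0 r)) := by
      let _ : NormedSpace ℝ E := NormedSpace.restrictScalars ℝ ℂ E
      refine IsPreconnected.image ?_ _ (φ.continuousOn_symm.mono (by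
        rw [hφt]; exact Set.inter_subset_right))
      exact (((L.restrictScalars ℝ).convex).inter (convex_ball 0 r)).isPreconnected
    refine hpre.subset_connectedComponentIn (F := isotropyType (MulAction.stabilizer G x))
      ⟨0, ⟨L.zero_mem, Metric.mem_ball_self hr⟩, by rw [← hφy, φ.left_inv hyφ]⟩ ?_
      ⟨φ z, ⟨h, by rw [← hφt]; exact φ.map_source hz⟩, φ.left_inv hz⟩
    rintro _ ⟨v, ⟨hvL, hv⟩, rfl⟩
    rw [← hφt] at hv
    rw [hiff _ (φ.map_target hv), φ.right_inv hv]
    exact hvL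

lemma smul_of_mem_stratum {x y : X} (hy : y ∈ (stratum (G := G) E x).carrier)
    (h : MulAction.stabilizer G x) : (h : G) • y = y := by
  have : MulAction.stabilizer G y = MulAction.stabilizer G x :=
    connectedComponentIn_subset (isotropyType (MulAction.stabilizer G x)) x hy
  have h2 : (h : G) ∈ MulAction.stabilizer G y := by rw [this]; exact h.2
  exact h2

/-- A linear slice at `x`: an open neighbourhood `W` of `x` which is invariant under `H = Stab(x)`,
satisfies `W ∩ gW = ∅` for `g ∉ H`, and is `H`-equivariantly biholomorphic, by `φ`, to an open
subset of the vector space `E`, on which `H` acts by a linear representation `σ`. -/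
structure LinearSlice (x : X) where
  W : Opens X
  mem : x ∈ W
  smul_mem : ∀ g ∈ MulAction.stabilizer G x, ∀ w ∈ W, g • w ∈ W
  smul_notMem : ∀ g ∉ MulAction.stabilizer G x, ∀ w ∈ W, g • w ∉ W
  σ : Representation ℂ (MulAction.stabilizer G x) E
  φ : OpenPartialHomeomorph X E
  mem_atlas : φ ∈ IsManifold.maximalAtlas 𝓘(ℂ, E) ω X
  source_eq : φ.source = W
  map_smul : ∀ (h : MulAction.stabilizer G x), ∀ w ∈ W, φ ((h : G) • w) = σ h (φ w)

variable {E}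

/-- The image of the slice is contained in the product of the image of the stratum, which lies in
`E^H`, and of the unique `H`-invariant complement `ker (∑ₕ σ(h))` of `E^H`. -/
def LinearSlice.InProduct {x : X} (S : LinearSlice (G := G) E x) : Prop :=
  ∀ w ∈ S.W, ∃ y ∈ S.W, y ∈ (stratum (G := G) E x).carrier ∧
    S.φ w - S.φ y ∈ LinearMap.ker (∑ᶠ h, S.σ h)

/-- The restriction of a map to open subsets. -/
def restrict {M M' : Type u} [TopologicalSpace M] [TopologicalSpace M'] (f : M → M')
    {U : Opens M} {V : Opens M'} (h : ∀ y ∈ U, f y ∈ V) (y : U) : V := ⟨f y, h y y.2⟩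

theorem contMDiff_restrict {M M' : Type u} [TopologicalSpace M] [ChartedSpace E M]
    [TopologicalSpace M'] [ChartedSpace E M'] {f : M → M'} (hf : ContMDiff 𝓘(ℂ, E) 𝓘(ℂ, E) ω f)
    {U : Opens M} {V : Opens M'} (h : ∀ y ∈ U, f y ∈ V) :
    ContMDiff 𝓘(ℂ, E) 𝓘(ℂ, E) ω (restrict f h : U → V) := by
  intro y
  have h1 : ContMDiffAt 𝓘(ℂ, E) 𝓘(ℂ, E) ω (Subtype.val ∘ (restrict f h : U → V)) y :=
    hf.contMDiffAt.comp y (contMDiff_subtype_val y)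
  exact (ChartedSpace.liftPropWithinAt_subtypeVal_comp_iff ..).1 h1

variable (E) in
/-- The action of `h ∈ H = Stab(x)` on the normal bundle `N` of the stratum through `x`,
`(y, [v]) ↦ (hy, [dh_y v]) = (y, [dh_y v])`. -/
def normalSMul (x : X) (h : MulAction.stabilizer G x) :
    NormalBundle (stratum (G := G) E x) → NormalBundle (stratum (G := G) E x) :=
  NormalBundle.map (HolomorphicAction.contMDiff_smul (h : G)) fun y hy => by
    rw [smul_of_mem_stratum E hy]; exact hy

/-- The zero section of a normal bundle, as a subset of the total space. -/
def zeroSection (S : ComplexSubmanifold E X) : Set (NormalBundle S) := {p | p.vec = 0}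

namespace LinearSlice

variable {x : X} (S : LinearSlice (G := G) E x)

/-- The part `W ∩ X_H^i` of the stratum in the slice `W`. -/
def stratumPart : Set S.W := {w | (w : X) ∈ (stratum (G := G) E x).carrier}

/-- The action of `h ∈ H` on the slice `W`. -/
def smul (h : MulAction.stabilizer G x) : S.W → S.W :=
  restrict (fun y => (h : G) • y) (S.smul_mem h h.2)

/-- The action of `h ∈ H` on the formal completion of the slice `W` along `W ∩ X_H^i`. -/
def completionSMul (h : MulAction.stabilizer G x) :
    formalCompletion E S.stratumPart ⟶ formalCompletion E S.stratumPart :=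
  formalCompletionMap (f := S.smul h)
    (contMDiff_restrict (HolomorphicAction.contMDiff_smul (h : G)) (S.smul_mem h h.2))
    fun w hw => by
      change (h : G) • (w : X) ∈ (stratum (G := G) E x).carrier
      rw [smul_of_mem_stratum E hw]; exact hw

end LinearSlice

/-- The part of the zero section in an open subset `V` of the normal bundle. -/
def zeroPart {S : ComplexSubmanifold E X} (V : Opens (NormalBundle S)) : Set V :=
  {p | (p : NormalBundle S) ∈ zeroSection S}

lemma normalSMul_zero (x : X) (h : MulAction.stabilizer G x)
    {p : NormalBundle (stratum (G := G) E x)} (hp : p ∈ zeroSection (stratum (G := G) E x)) :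
    normalSMul E x h p ∈ zeroSection (stratum (G := G) E x) := by
  change (normalSMul E x h p).vec = 0
  change p.vec = 0 at hp
  unfold normalSMul NormalBundle.map
  simp only [hp, map_zero]

/-- The action of `h ∈ H` on the formal completion along the zero section of an `H`-invariant open
subset `V` of the normal bundle of the stratum through `x`. -/
def normalCompletionSMul {x : X} {V : Opens (NormalBundle (stratum (G := G) E x))}
    (hV : ∀ h : MulAction.stabilizer G x, ∀ p ∈ V, normalSMul E x h p ∈ V)
    (h : MulAction.stabilizer G x) :
    formalCompletion E (zeroPart V) ⟶ formalCompletion E (zeroPart V) :=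
  formalCompletionMap (f := restrict (normalSMul E x h) (hV h))
    (contMDiff_restrict (NormalBundle.contMDiff_map _ _) (hV h))
    fun _ hp => normalSMul_zero x h hp

end Statement

end HolTube

end

open HolTube

/-!
The slice is given with a chart `φ` in which `H` acts linearly, and the tubular map is the identity
in suitable coordinates of the normal bundle `N`.

Points of the slice `W` have isotropy group contained in `H`, so a point `w ∈ W` lies in the
isotropy type of `H` exactly when `φ w` lies in the space `E^H` of invariants. If moreover
`φ(W) ⊆ φ(W ∩ X_H^i) × C`, then a point of `W` with invariant coordinates must lie in the stratum
`X_H^i`, because `E^H ∩ C = 0` (`LinearSlice.InProduct.mem_stratum_iff`). Hence `φ`, together with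
the decomposition `E = E^H ⊕ C`, is a chart of `X` adapted to the stratum, and it induces a chart
`(y, [v]) ↦ φ(y) + pr_C (dφ_y v)` of `N` over all of `W ∩ X_H^i`. The same condition says that
`φ(W)` is contained in the target of this chart, so `ζ := (chart of N)⁻¹ ∘ φ`
(`LinearSlice.InProduct.tube`) is a biholomorphism of `W` onto an open subset of `N`.

In the chart of `N` the group `H` again acts by `σ`: this is the chain rule for
`h • φ⁻¹(b) = φ⁻¹(σ(h) b)` at invariant points (`LinearSlice.mfderiv_smul_dinv`,
`LinearSlice.normalSMul_coordInv`), whence the equivariance of `ζ`. The zero section is the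
subspace `E^H` in the chart, so `ζ` identifies `W ∩ X_H^i` with the zero section in the image.
Everything about formal completions then follows by functoriality (`formalCompletionMap_comp`,
`formalCompletionMap_id`): `ζ⁻¹` induces the inverse of the morphism induced by `ζ`, and the
equivariance of `ζ` is passed on to that morphism.
-/

namespace HolTube

/-! ### Functoriality of formal completions -/

section Functoriality

variable {E : Type} [NormedAddCommGroup E] [NormedSpace ℂ E]
variable {M M' M'' : Type u} [TopologicalSpace M] [ChartedSpace E M]
  [TopologicalSpace M'] [ChartedSpace E M'] [TopologicalSpace M''] [ChartedSpace E M'']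

lemma InfNbhd.comap_comp {f : M → M'} (hf : ContMDiff 𝓘(ℂ, E) 𝓘(ℂ, E) ω f) {g : M' → M''}
    (hg : ContMDiff 𝓘(ℂ, E) 𝓘(ℂ, E) ω g) {Z : Set M} {Z' : Set M'} {Z'' : Set M''}
    (hZ : Set.MapsTo f Z Z') (hZ' : Set.MapsTo g Z' Z'') (y : M) (ν : ℕ)
    (a : InfNbhd E Z'' (g (f y)) ν) :
    InfNbhd.comap hf hZ y ν (InfNbhd.comap hg hZ' (f y) ν a) =
      InfNbhd.comap (hg.comp hf) (hZ'.comp hZ) y ν a := by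
  obtain ⟨⟨_, b, hb, rfl⟩, rfl⟩ := Ideal.Quotient.mk_surjective a
  rfl

lemma InfNbhd.comap_id {Z : Set M} (y : M) (ν : ℕ) (a : InfNbhd E Z y ν) :
    InfNbhd.comap (contMDiff_id : ContMDiff 𝓘(ℂ, E) 𝓘(ℂ, E) ω (id : M → M))
      (Set.mapsTo_id Z) y ν a = a := by
  obtain ⟨⟨_, b, hb, rfl⟩, rfl⟩ := Ideal.Quotient.mk_surjective a
  rfl

lemma formalCompletionMap_comp {f : M → M'} (hf : ContMDiff 𝓘(ℂ, E) 𝓘(ℂ, E) ω f) {g : M' → M''}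
    (hg : ContMDiff 𝓘(ℂ, E) 𝓘(ℂ, E) ω g) {Z : Set M} {Z' : Set M'} {Z'' : Set M''}
    (hZ : Set.MapsTo f Z Z') (hZ' : Set.MapsTo g Z' Z'') :
    formalCompletionMap hf hZ ≫ formalCompletionMap hg hZ' =
      formalCompletionMap (hg.comp hf) (hZ'.comp hZ) := by
  refine InducedCategory.hom_ext (AlgebraicGeometry.PresheafedSpace.hext _ _ rfl (heq_of_eq ?_))
  refine NatTrans.ext (funext fun U => CommAlgCat.hom_ext (AlgHom.ext fun s =>
    Subtype.ext (funext fun y => funext fun ν => ?_)))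
  exact InfNbhd.comap_comp hf hg hZ hZ' y.1.1 ν _

lemma formalCompletionMap_id (Z : Set M) :
    formalCompletionMap (contMDiff_id : ContMDiff 𝓘(ℂ, E) 𝓘(ℂ, E) ω (id : M → M))
      (Set.mapsTo_id Z) = 𝟙 (formalCompletion E Z) := by
  refine InducedCategory.hom_ext (AlgebraicGeometry.PresheafedSpace.hext _ _ rfl (heq_of_eq ?_))
  refine NatTrans.ext (funext fun U => CommAlgCat.hom_ext (AlgHom.ext fun s =>
    Subtype.ext (funext fun y => funext fun ν => ?_)))
  exact InfNbhd.comap_id y.1.1 ν _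

lemma formalCompletionMap_congr {f g : M → M'} (hf : ContMDiff 𝓘(ℂ, E) 𝓘(ℂ, E) ω f)
    (hg : ContMDiff 𝓘(ℂ, E) 𝓘(ℂ, E) ω g) {Z : Set M} {Z' : Set M'}
    (hZ : Set.MapsTo f Z Z') (hZ' : Set.MapsTo g Z Z') (h : f = g) :
    formalCompletionMap hf hZ = formalCompletionMap hg hZ' := by
  subst h
  rfl

/-- A biholomorphism which identifies `Z` with `Z'` induces an isomorphism of the formal
completions along `Z` and `Z'`; its inverse is induced by the inverse biholomorphism. -/
theorem isIso_formalCompletionMap (ζ : M ≃ₘ^ω⟮𝓘(ℂ, E), 𝓘(ℂ, E)⟯ M') {Z : Set M} {Z' : Set M'}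
    (hZ : Set.MapsTo ζ Z Z') (hZ' : Set.MapsTo ζ.symm Z' Z) :
    IsIso (formalCompletionMap ζ.contMDiff hZ) := by
  refine ⟨formalCompletionMap ζ.symm.contMDiff hZ', ?_, ?_⟩
  · rw [formalCompletionMap_comp, ← formalCompletionMap_id]
    exact formalCompletionMap_congr _ _ _ _ (funext ζ.symm_apply_apply)
  · rw [formalCompletionMap_comp, ← formalCompletionMap_id]
    exact formalCompletionMap_congr _ _ _ _ (funext ζ.apply_symm_apply)

end Functoriality

/-! ### Biholomorphisms between open subsets -/

section Biholomorphism

variable {E : Type} [NormedAddCommGroup E] [NormedSpace ℂ E]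
variable {M M' : Type u} [TopologicalSpace M] [ChartedSpace E M]
  [TopologicalSpace M'] [ChartedSpace E M']

lemma contMDiff_opens_of_contMDiffOn {U : Opens M} {V : Opens M'} {f : M → M'}
    (hf : ContMDiffOn 𝓘(ℂ, E) 𝓘(ℂ, E) ω f U) (g : U → V) (hg : ∀ y : U, (g y : M') = f y) :
    ContMDiff 𝓘(ℂ, E) 𝓘(ℂ, E) ω g := by
  intro y
  have h1 : ContMDiffAt 𝓘(ℂ, E) 𝓘(ℂ, E) ω (Subtype.val ∘ g) y := by
    rw [show Subtype.val ∘ g = f ∘ Subtype.val from funext hg]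
    exact (hf.contMDiffAt (U.isOpen.mem_nhds y.2)).comp y (contMDiff_subtype_val y)
  exact (ChartedSpace.liftPropWithinAt_subtypeVal_comp_iff ..).1 h1

/-- A partial homeomorphism which is holomorphic in both directions, as a biholomorphism of its
source onto its target. -/
def sourceTargetDiffeomorph (e : OpenPartialHomeomorph M M')
    (he : ContMDiffOn 𝓘(ℂ, E) 𝓘(ℂ, E) ω e e.source)
    (he' : ContMDiffOn 𝓘(ℂ, E) 𝓘(ℂ, E) ω e.symm e.target) {U : Opens M} {V : Opens M'}
    (hU : e.source = U) (hV : e.target = V) : U ≃ₘ^ω⟮𝓘(ℂ, E), 𝓘(ℂ, E)⟯ V where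
  toFun y := ⟨e y, by
    have h : (y : M) ∈ e.source := hU ▸ y.2
    exact (hV ▸ e.map_source h : e y ∈ (V : Set M'))⟩
  invFun y := ⟨e.symm y, by
    have h : (y : M') ∈ e.target := hV ▸ y.2
    exact (hU ▸ e.map_target h : e.symm y ∈ (U : Set M))⟩
  left_inv y := Subtype.ext (e.left_inv (hU ▸ y.2 : (y : M) ∈ e.source))
  right_inv y := Subtype.ext (e.right_inv (hV ▸ y.2 : (y : M') ∈ e.target))
  contMDiff_toFun := contMDiff_opens_of_contMDiffOn (hU ▸ he) _ fun _ => rfl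
  contMDiff_invFun := contMDiff_opens_of_contMDiffOn (hV ▸ he') _ fun _ => rfl

end Biholomorphism

/-! ### Charts of the normal bundle -/

namespace NormalBundle

variable {E : Type} [NormedAddCommGroup E] [NormedSpace ℂ E] [FiniteDimensional ℂ E]
variable {X : Type u} [TopologicalSpace X] [ChartedSpace E X] [IsManifold 𝓘(ℂ, E) ω X]
variable {S : ComplexSubmanifold E X}

/-- `chart A p₀` as a partial homeomorphism for the topology of the normal bundle. -/
noncomputable def chartHomeo (A : AdaptedChart E S.carrier) (p₀ : NormalBundle S) :
    OpenPartialHomeomorph (NormalBundle S) E :=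
  (core S).openPartialHomeomorph (chart A p₀) ⟨A, p₀, rfl⟩

lemma chartHomeo_mem_maximalAtlas (A : AdaptedChart E S.carrier) (p₀ : NormalBundle S) :
    chartHomeo A p₀ ∈ IsManifold.maximalAtlas 𝓘(ℂ, E) ω (NormalBundle S) := by
  apply IsManifold.subset_maximalAtlas
  change _ ∈ ⋃ (e : PartialEquiv (NormalBundle S) E) (he : e ∈ (core S).atlas),
    {(core S).openPartialHomeomorph e he}
  simp only [Set.mem_iUnion, Set.mem_singleton_iff]
  exact ⟨chart A p₀, ⟨A, p₀, rfl⟩, rfl⟩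

/-- In the chart of the normal bundle given by `A`, the zero section is the subspace `A.L`. -/
lemma mem_zeroSection_iff_coord (A : AdaptedChart E S.carrier) {p : NormalBundle S}
    (hp : p.pt ∈ A.φ.source) : p ∈ zeroSection S ↔ coord A p ∈ A.L := by
  rw [← A.πC_eq_zero_iff, πC_coord A p hp, A.πC_eq_zero_iff, ← A.mem_tangentAlong hp p.mem]
  have h : p.vec = Submodule.Quotient.mk p.rep :=
    eq_of_heq (NormalBundle.mk.inj p.mk'_rep).2.symm
  change p.vec = 0 ↔ _
  rw [h]
  exact Submodule.Quotient.mk_eq_zero _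

end NormalBundle

/-! ### The linear slice as an adapted chart -/

namespace LinearSlice

variable {E : Type} [NormedAddCommGroup E] [NormedSpace ℂ E] [FiniteDimensional ℂ E]
variable {G : Type*} [Group G] [Finite G]
variable {X : Type u} [TopologicalSpace X] [ChartedSpace E X] [T2Space X]
  [IsManifold 𝓘(ℂ, E) ω X] [MulAction G X] [HolomorphicAction E G X]
variable {x : X} (S : LinearSlice (G := G) E x)

lemma sum_apply_of_mem_invariants {v : E} (hv : v ∈ S.σ.invariants) :
    (∑ᶠ h, S.σ h) v = (Nat.card (MulAction.stabilizer G x) : ℂ) • v := by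
  classical
  have := Fintype.ofFinite (MulAction.stabilizer G x)
  rw [finsum_eq_sum_of_fintype, LinearMap.sum_apply,
    Finset.sum_congr rfl fun h _ => (S.σ.mem_invariants v).1 hv h, Finset.sum_const,
    Finset.card_univ, Nat.card_eq_fintype_card, Nat.cast_smul_eq_nsmul]

lemma smul_sum_apply (k : MulAction.stabilizer G x) (v : E) :
    S.σ k ((∑ᶠ h, S.σ h) v) = (∑ᶠ h, S.σ h) v := by
  classical
  have := Fintype.ofFinite (MulAction.stabilizer G x)
  rw [finsum_eq_sum_of_fintype, LinearMap.sum_apply, map_sum, ← Equiv.sum_comp (Equiv.mulLeft k)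
    (fun h => S.σ h v)]
  exact Finset.sum_congr rfl fun h _ => by
    rw [Equiv.coe_mulLeft, map_mul, Module.End.mul_apply]

lemma sum_apply_smul (k : MulAction.stabilizer G x) (v : E) :
    (∑ᶠ h, S.σ h) (S.σ k v) = (∑ᶠ h, S.σ h) v := by
  classical
  have := Fintype.ofFinite (MulAction.stabilizer G x)
  rw [finsum_eq_sum_of_fintype, LinearMap.sum_apply, LinearMap.sum_apply,
    ← Equiv.sum_comp (Equiv.mulRight k) (fun h => S.σ h v)]
  exact Finset.sum_congr rfl fun h _ => by
    rw [Equiv.coe_mulRight, map_mul, Module.End.mul_apply]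

lemma isCompl_invariants_ker : IsCompl S.σ.invariants (LinearMap.ker (∑ᶠ h, S.σ h)) := by
  have hn : (Nat.card (MulAction.stabilizer G x) : ℂ) ≠ 0 :=
    Nat.cast_ne_zero.2 Nat.card_pos.ne'
  have hp : LinearMap.IsProj S.σ.invariants
      ((Nat.card (MulAction.stabilizer G x) : ℂ)⁻¹ • ∑ᶠ h, S.σ h) :=
    ⟨fun v => Submodule.smul_mem _ _ ((S.σ.mem_invariants _).2 fun k => S.smul_sum_apply k v),
      fun v hv => by
        rw [LinearMap.smul_apply, S.sum_apply_of_mem_invariants hv, smul_smul,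
          inv_mul_cancel₀ hn, one_smul]⟩
  rw [← LinearMap.ker_smul (∑ᶠ h, S.σ h) _ (inv_ne_zero hn)]
  exact hp.isCompl

/-- Points of the slice whose isotropy group is the whole of `H` are those with invariant
coordinates: the isotropy groups in a slice are contained in `H`. -/
lemma mem_isotropyType_iff {w : X} (hw : w ∈ S.W) :
    w ∈ isotropyType (MulAction.stabilizer G x) ↔ S.φ w ∈ S.σ.invariants := by
  rw [Representation.mem_invariants]
  constructor
  · intro h k
    have hk : (k : G) ∈ MulAction.stabilizer G w := by
      rw [show MulAction.stabilizer G w = _ from h]; exact k.2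
    rw [← S.map_smul k w hw, show (k : G) • w = w from hk]
  · intro h
    have hfix : ∀ k : MulAction.stabilizer G x, (k : G) • w = w := fun k =>
      S.φ.injOn (by rw [S.source_eq]; exact S.smul_mem k k.2 w hw)
        (by rw [S.source_eq]; exact hw) ((S.map_smul k w hw).trans (h k))
    change MulAction.stabilizer G w = _
    ext g
    refine ⟨fun hg => ?_, fun hg => hfix ⟨g, hg⟩⟩
    by_contra hgH
    refine S.smul_notMem g hgH w hw ?_
    rw [show g • w = w from hg]; exact hw

variable {S}

/-- Under the product condition the slice meets no component of the isotropy type other than the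
stratum through `x`. -/
lemma InProduct.mem_stratum_iff (hS : S.InProduct) {w : X} (hw : w ∈ S.W) :
    w ∈ (stratum (G := G) E x).carrier ↔ S.φ w ∈ S.σ.invariants := by
  have hsub : ∀ y ∈ (stratum (G := G) E x).carrier,
      y ∈ isotropyType (MulAction.stabilizer G x) := fun y hy =>
    connectedComponentIn_subset (isotropyType (MulAction.stabilizer G x)) x hy
  rw [← S.mem_isotropyType_iff hw]
  refine ⟨hsub w, fun h => ?_⟩
  obtain ⟨y, hyW, hy, hC⟩ := hS w hw
  -- The difference of the coordinates lies in `E^H ∩ C = 0`, so `w` is the point `y`.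
  have h0 : S.φ w - S.φ y = 0 := Submodule.disjoint_def.1 S.isCompl_invariants_ker.disjoint _
    (Submodule.sub_mem _ ((S.mem_isotropyType_iff hw).1 h)
      ((S.mem_isotropyType_iff hyW).1 (hsub y hy))) hC
  have hwy : w = y := S.φ.injOn (by rw [S.source_eq]; exact hw) (by rw [S.source_eq]; exact hyW)
    (sub_eq_zero.1 h0)
  rwa [hwy]

/-- The linear chart of the slice, adapted to the stratum by the decomposition `E = E^H ⊕ C`. -/
noncomputable def InProduct.adaptedChart (hS : S.InProduct) :
    AdaptedChart E (stratum (G := G) E x).carrier where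
  φ := S.φ
  mem_atlas := S.mem_atlas
  L := S.σ.invariants
  C := LinearMap.ker (∑ᶠ h, S.σ h)
  compl := S.isCompl_invariants_ker
  mem_iff z hz := hS.mem_stratum_iff (by rw [S.source_eq] at hz; exact hz)

lemma InProduct.πL_mem_target (hS : S.InProduct) {w : X} (hw : w ∈ S.W) :
    hS.adaptedChart.πL (S.φ w) ∈ S.φ.target := by
  obtain ⟨y, hyW, hy, hC⟩ := hS w hw
  have h1 := hS.adaptedChart.πL_eq_zero_iff.2 hC
  rw [map_sub, sub_eq_zero, hS.adaptedChart.πL_of_mem ((hS.mem_stratum_iff hyW).1 hy)] at h1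
  rw [h1]
  exact S.φ.map_source (by rw [S.source_eq]; exact hyW)

lemma InProduct.πC_smul (hS : S.InProduct) (h : MulAction.stabilizer G x) (u : E) :
    hS.adaptedChart.πC (S.σ h u) = S.σ h (hS.adaptedChart.πC u) := by
  set A := hS.adaptedChart
  have h1 : S.σ h (A.πL u) = A.πL u := (S.σ.mem_invariants _).1 (A.πL_mem u) h
  have h2 : S.σ h (A.πC u) ∈ A.C := by
    change (∑ᶠ k, S.σ k) _ = 0
    rw [S.sum_apply_smul]
    exact A.πC_mem u
  conv_lhs => rw [← A.πL_add_πC u]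
  rw [map_add, map_add, h1, A.πC_eq_zero_iff.2 (A.πL_mem u), A.πC_of_mem h2, zero_add]

lemma InProduct.πL_smul (hS : S.InProduct) (h : MulAction.stabilizer G x) (u : E) :
    hS.adaptedChart.πL (S.σ h u) = hS.adaptedChart.πL u := by
  set A := hS.adaptedChart
  have h1 : S.σ h (A.πL u) = A.πL u := (S.σ.mem_invariants _).1 (A.πL_mem u) h
  have h2 := A.πL_add_πC (S.σ h u)
  conv_rhs at h2 => rw [← A.πL_add_πC u, map_add, h1]
  rw [hS.πC_smul] at h2
  exact add_right_cancel h2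

/-- Differentiating the identity `h • φ⁻¹(b) = φ⁻¹(σ(h) b)` at a fixed point `a` of `σ(h)`. -/
lemma mfderiv_smul_dinv (hS : S.InProduct) (h : MulAction.stabilizer G x) {a : E}
    (ha : a ∈ S.φ.target) (hfix : S.σ h a = a) (c : E) :
    (mfderiv 𝓘(ℂ, E) 𝓘(ℂ, E) (fun y : X => (h : G) • y) (S.φ.symm a) : E →L[ℂ] E)
      (hS.adaptedChart.dinv a c) = hS.adaptedChart.dinv a (S.σ h c) := by
  set A := hS.adaptedChart
  let s : E →L[ℂ] E := LinearMap.toContinuousLinearMap (S.σ h)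
  have hs : s a = a := hfix
  have h0 := (A.mdiff.mdifferentiableAt_symm ha).hasMFDerivAt
  have h1 := ((HolomorphicAction.contMDiff_smul (E := E) (h : G) (S.φ.symm a)).mdifferentiableAt
    (by simp)).hasMFDerivAt.comp a h0
  have h2 : HasMFDerivAt 𝓘(ℂ, E) 𝓘(ℂ, E) (A.φ.symm ∘ s) a ((A.dinv (s a)).comp s) :=
    HasMFDerivAt.comp a
      (A.mdiff.mdifferentiableAt_symm (by rw [hs]; exact ha)).hasMFDerivAt
      s.hasFDerivAt.hasMFDerivAt
  have heq : (fun y : X => (h : G) • y) ∘ A.φ.symm =ᶠ[𝓝 a] A.φ.symm ∘ s := by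
    filter_upwards [S.φ.open_target.mem_nhds ha] with b hb
    have hbW : S.φ.symm b ∈ S.W := by
      have := S.φ.map_target hb
      rw [S.source_eq] at this; exact this
    change (h : G) • S.φ.symm b = S.φ.symm (S.σ h b)
    have h3 : (h : G) • S.φ.symm b ∈ S.φ.source := by
      rw [S.source_eq]; exact S.smul_mem h h.2 _ hbW
    rw [← S.φ.left_inv h3, S.map_smul h _ hbW, S.φ.right_inv hb]
  have h4 := DFunLike.congr_fun (hasMFDerivAt_unique h1 (h2.congr_of_eventuallyEq heq)) c
  refine Eq.trans h4 ?_
  change A.dinv (s a) (S.σ h c) = _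
  rw [hs]

/-- In the chart of the normal bundle given by the slice, `H` acts by the linear action `σ`. -/
lemma normalSMul_coordInv (hS : S.InProduct) (h : MulAction.stabilizer G x)
    (p₀ : NormalBundle (stratum (G := G) E x)) {u : E}
    (hu : hS.adaptedChart.πL u ∈ S.φ.target) :
    normalSMul E x h (NormalBundle.coordInv hS.adaptedChart p₀ u) =
      NormalBundle.coordInv hS.adaptedChart p₀ (S.σ h u) := by
  set A := hS.adaptedChart
  have hu' : A.πL (S.σ h u) ∈ A.φ.target := by rw [hS.πL_smul]; exact hu
  rw [NormalBundle.coordInv_of_mem A p₀ hu, NormalBundle.coordInv_of_mem A p₀ hu']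
  refine (NormalBundle.map_mk' _ _ (NormalBundle.symm_mem A hu) _).trans
    (NormalBundle.mk'_eq ?_ ?_)
  · rw [hS.πL_smul]
    exact smul_of_mem_stratum E (NormalBundle.symm_mem A hu) h
  · have h1 := mfderiv_smul_dinv hS h hu ((S.σ.mem_invariants _).1 (A.πL_mem u) h) (A.πC u)
    rw [hS.πL_smul, hS.πC_smul]
    exact Set.mem_of_eq_of_mem (sub_eq_zero.2 h1) (Submodule.zero_mem
      (tangentAlong E (stratum (G := G) E x).carrier _ : Submodule ℂ E))

/-! ### The tubular biholomorphism -/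

/-- The partial homeomorphism from `X` to the normal bundle which is the identity in the
coordinates of the slice. -/
noncomputable def InProduct.tube (hS : S.InProduct)
    (p₀ : NormalBundle (stratum (G := G) E x)) :
    OpenPartialHomeomorph X (NormalBundle (stratum (G := G) E x)) :=
  S.φ.trans (NormalBundle.chartHomeo hS.adaptedChart p₀).symm

lemma InProduct.tube_source (hS : S.InProduct) (p₀ : NormalBundle (stratum (G := G) E x)) :
    (hS.tube p₀).source = S.W := by
  rw [InProduct.tube, OpenPartialHomeomorph.trans_source, S.source_eq]
  exact Set.inter_eq_left.2 fun w hw => hS.πL_mem_target hw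

lemma InProduct.contMDiffOn_tube (hS : S.InProduct)
    (p₀ : NormalBundle (stratum (G := G) E x)) :
    ContMDiffOn 𝓘(ℂ, E) 𝓘(ℂ, E) ω (hS.tube p₀) (hS.tube p₀).source := by
  refine (contMDiffOn_symm_of_mem_maximalAtlas
    (NormalBundle.chartHomeo_mem_maximalAtlas hS.adaptedChart p₀)).comp
    ((contMDiffOn_of_mem_maximalAtlas S.mem_atlas).mono fun w hw => hw.1) fun w hw => hw.2

lemma InProduct.contMDiffOn_tube_symm (hS : S.InProduct)
    (p₀ : NormalBundle (stratum (G := G) E x)) :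
    ContMDiffOn 𝓘(ℂ, E) 𝓘(ℂ, E) ω (hS.tube p₀).symm (hS.tube p₀).target := by
  refine (contMDiffOn_symm_of_mem_maximalAtlas S.mem_atlas).comp
    ((contMDiffOn_of_mem_maximalAtlas
      (NormalBundle.chartHomeo_mem_maximalAtlas hS.adaptedChart p₀)).mono fun p hp => hp.1)
    fun p hp => hp.2

lemma InProduct.tube_smul (hS : S.InProduct) (p₀ : NormalBundle (stratum (G := G) E x))
    (h : MulAction.stabilizer G x) {w : X} (hw : w ∈ S.W) :
    hS.tube p₀ ((h : G) • w) = normalSMul E x h (hS.tube p₀ w) := by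
  refine Eq.trans ?_ (normalSMul_coordInv hS h p₀ (hS.πL_mem_target hw)).symm
  exact congrArg (NormalBundle.coordInv hS.adaptedChart p₀) (S.map_smul h w hw)

lemma InProduct.tube_pt_mem (hS : S.InProduct) (p₀ : NormalBundle (stratum (G := G) E x))
    {w : X} (hw : w ∈ S.W) : (hS.tube p₀ w).pt ∈ S.φ.source :=
  (NormalBundle.chart hS.adaptedChart p₀).map_target (hS.πL_mem_target hw)

lemma InProduct.tube_mem_zeroSection_iff (hS : S.InProduct)
    (p₀ : NormalBundle (stratum (G := G) E x)) {w : X} (hw : w ∈ S.W) :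
    hS.tube p₀ w ∈ zeroSection (stratum (G := G) E x) ↔
      w ∈ (stratum (G := G) E x).carrier := by
  rw [NormalBundle.mem_zeroSection_iff_coord hS.adaptedChart (hS.tube_pt_mem p₀ hw),
    hS.mem_stratum_iff hw]
  have h1 : NormalBundle.coord hS.adaptedChart (hS.tube p₀ w) = S.φ w :=
    (NormalBundle.chart hS.adaptedChart p₀).right_inv (hS.πL_mem_target hw)
  rw [h1]
  rfl

end LinearSlice

end HolTube

theorem mainTheorem5 {n : ℕ} {X : Type u} [TopologicalSpace X] [T2Space X]
    [ChartedSpace (EuclideanSpace ℂ (Fin n)) X] [IsManifold 𝓘(ℂ, EuclideanSpace ℂ (Fin n)) ω X]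
    {G : Type*} [Group G] [Finite G] [MulAction G X]
    [HolomorphicAction (EuclideanSpace ℂ (Fin n)) G X] (x : X)
    (S : LinearSlice (G := G) (EuclideanSpace ℂ (Fin n)) x) (hS : S.InProduct) :
    ∃ (V : Opens (NormalBundle (stratum (G := G) (EuclideanSpace ℂ (Fin n)) x)))
      (hV : ∀ h : MulAction.stabilizer G x, ∀ p ∈ V,
        normalSMul (EuclideanSpace ℂ (Fin n)) x h p ∈ V)
      (ζ : S.W ≃ₘ^ω⟮𝓘(ℂ, EuclideanSpace ℂ (Fin n)), 𝓘(ℂ, EuclideanSpace ℂ (Fin n))⟯ V)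
      (hζ : Set.MapsTo ζ S.stratumPart (zeroPart V)),
      (∀ p ∈ V, p.pt ∈ S.W) ∧
      (∀ (h : MulAction.stabilizer G x) (w : S.W),
        (ζ (S.smul h w)).1 = normalSMul (EuclideanSpace ℂ (Fin n)) x h (ζ w).1) ∧
      IsIso (formalCompletionMap ζ.contMDiff hζ) ∧
      ∀ h : MulAction.stabilizer G x,
        S.completionSMul h ≫ formalCompletionMap ζ.contMDiff hζ =
          formalCompletionMap ζ.contMDiff hζ ≫ normalCompletionSMul hV h := by
  -- The chart of the normal bundle needs some point of it as a default value.
  let p₀ : NormalBundle (stratum (G := G) (EuclideanSpace ℂ (Fin n)) x) :=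
    NormalBundle.mk' x (mem_connectedComponentIn rfl) 0
  let V : Opens (NormalBundle (stratum (G := G) (EuclideanSpace ℂ (Fin n)) x)) :=
    ⟨(hS.tube p₀).target, (hS.tube p₀).open_target⟩
  let ζ : S.W ≃ₘ^ω⟮𝓘(ℂ, EuclideanSpace ℂ (Fin n)), 𝓘(ℂ, EuclideanSpace ℂ (Fin n))⟯ V :=
    sourceTargetDiffeomorph (hS.tube p₀) (hS.contMDiffOn_tube p₀) (hS.contMDiffOn_tube_symm p₀)
      (hS.tube_source p₀) rfl
  have hζval : ∀ w : S.W, (ζ w).1 = hS.tube p₀ w := fun _ => rfl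
  have hequiv : ∀ (h : MulAction.stabilizer G x) (w : S.W),
      (ζ (S.smul h w)).1 = normalSMul (EuclideanSpace ℂ (Fin n)) x h (ζ w).1 := fun h w =>
    hS.tube_smul p₀ h w.2
  have hV : ∀ h : MulAction.stabilizer G x, ∀ p ∈ V,
      normalSMul (EuclideanSpace ℂ (Fin n)) x h p ∈ V := fun h p hp => by
    have h1 := hequiv h (ζ.symm ⟨p, hp⟩)
    rw [ζ.apply_symm_apply] at h1
    rw [← h1]
    exact (ζ _).2
  have hiff : ∀ w : S.W, ζ w ∈ zeroPart V ↔ w ∈ S.stratumPart := fun w =>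
    hS.tube_mem_zeroSection_iff p₀ w.2
  have hζ : Set.MapsTo ζ S.stratumPart (zeroPart V) := fun w hw => (hiff w).2 hw
  have hζ' : Set.MapsTo ζ.symm (zeroPart V) S.stratumPart := fun p hp => by
    rw [← hiff, ζ.apply_symm_apply]; exact hp
  refine ⟨V, hV, ζ, hζ, fun p hp => ?_, hequiv, isIso_formalCompletionMap ζ hζ hζ', fun h => ?_⟩
  · have h1 := hS.tube_pt_mem p₀ (ζ.symm ⟨p, hp⟩).2
    rw [← hζval, ζ.apply_symm_apply, S.source_eq] at h1
    exact h1
  · exact (formalCompletionMap_comp _ _ _ _).trans ((formalCompletionMap_congr _ _ _ _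
      (funext fun w => Subtype.ext (hequiv h w))).trans (formalCompletionMap_comp _ _ _ _).symm)
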